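/- **Theorem (strict ARMA(1,q) processes).** Let $m,d\ge 1$ and $q\ge 0$ be integers, and let $(Z_t)_{t\in\mathbb Z}$ be an i.i.d. sequence of $\mathbb C^d$-valued random vectors on a probability space. Let $\Psi_1\in\mathbb C^{m\times m}$ and $\Theta_0,\dots,\Theta_q\in\mathbb C^{m\times d}$. Let $S\in\mathbb C^{m\times m}$ be invertible such that $S^{-1}\Psi_1S$ is block diagonal with $H$ Jordan blocks $\Phi_1,\dots,\Phi_H$, where $\Phi_h$ has the eigenvalue $\lambda_h$ on the diagonal, entries $1$ directly below the diagonal and $0$ elsewhere, and begins in row $r_h$, with $1=r_1<r_2<\dots<r_H<r_{H+1}:=m+1$. Let $I_h$ be the $(r_{h+1}-r_h)\times m$ matrix with entries $I_h(i,j)=1$ if $j=i+r_h-1$ and $I_h(i,j)=0$ otherwise. Let $\|\cdot\|$ be any fixed vector norm on each $\mathbb C^s$ and $\log^+x=\log\max\{1,x\}$. A process $(X_t)_{t\in\mathbb Z}$ of random vectors is strictly stationary if all its finite dimensional distributions are shift invariant. Consider the equation $$Y_t-\Psi_1Y_{t-1}=\sum_{k=0}^q\Theta_kZ_{t-k}\quad\text{a.s.},\qquad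 t\in\mathbb Z. \tag{1}$$ **Existence.** Equation (1) has a strictly stationary solution $(Y_t)_{t\in\mathbb Z}$ (on the given probability space) if and only if the following three conditions hold: (i) for every $h$ with $|\lambda_h|\notin\{0,1\}$, $\ \mathbb E\log^+\bigl\|\bigl(\sum_{k=0}^q\Phi_h^{q-k}I_hS^{-1}\Theta_k\bigr)Z_0\bigr\|<\infty$; (ii) for every $h$ with $|\lambda_h|=1$ and $\lambda_h\ne1$ there is a constant $\alpha_h\in\mathbb C^{r_{h+1}-r_h}$ such that $$\Bigl(\sum_{k=0}^q\Phi_h^{q-k}I_hS^{-1}\Theta_k\Bigr)Z_0=\alpha_h\quad\text{a.s.};\tag{2}$$ (iii) for every $h$ with $\lambda_h=1$ there is a constant $\alpha_h\in\mathbb C^{r_{h+1}-r_h}$ whose first component is $0$ such that (2) holds. **Explicit solution.** Suppose that (i)–(iii) hold. For every $h$ with $|\lambda_h|=1$ the equation $(\mathrm{Id}-\Phi_h)f_h=\alpha_h$ has a solution $f_h$ (and $\mathrm{Id}-\Phi_h$ is invertible if moreover $\lambda_h\neq1$). For any choice of such solutions $f_h$, a strictly stationary solution of (1) is given by $Y_t=S\,(X_t^{(1)T},\dots,X_t^{(H)T})^T$,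 where $$X_t^{(h)}=\begin{cases}\sum_{j=0}^\infty\Phi_h^{j-q}\Bigl(\sum_{k=0}^{j\wedge q}\Phi_h^{q-k}I_hS^{-1}\Theta_k\Bigr)Z_{t-j},&|\lambda_h|\in(0,1),\\[1ex]-\sum_{j=1-q}^\infty\Phi_h^{-j-q}\Bigl(\sum_{k=(1-j)\vee0}^{q}\Phi_h^{q-k}I_hS^{-1}\Theta_k\Bigr)Z_{t+j},&|\lambda_h|>1,\\[1ex]\sum_{j=0}^{m+q-1}\Bigl(\sum_{k=0}^{j\wedge q}\Phi_h^{j-k}I_hS^{-1}\Theta_k\Bigr)Z_{t-j},&\lambda_h=0,\\[1ex]f_h+\sum_{j=0}^{q-1}\Bigl(\sum_{k=0}^{j}\Phi_h^{j-k}I_hS^{-1}\Theta_k\Bigr)Z_{t-j},&|\lambda_h|=1,\end{cases}$$ and the infinite series converge absolutely almost surely. **Uniqueness.** Suppose that (i)–(iii) hold and that the probability space carries a random variable that is uniformly distributed on $[0,1)$ and independent of $(Z_t)_{t\in\mathbb Z}$. Then the solution above is the unique strictly stationary solution of (1), up to almost sure equality, if and only if $|\lambda_h|\ne1$ for all $h\in\{1,\dots,H\}$.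 -/

import Mathlib

open MeasureTheory ProbabilityTheory Matrix

namespace StrictARMA

/-! ### Jordan block form -/

/-- The `n × n` Jordan block with eigenvalue `lam`, the entries `1` being below the diagonal. -/
noncomputable def jordanBlock (n : ℕ) (lam : ℂ) : Matrix (Fin n) (Fin n) ℂ :=
  Matrix.of fun i j => if i = j then lam else if (i : ℕ) = (j : ℕ) + 1 then 1 else 0

/-- A division of the `m` rows into `H` consecutive non-empty blocks; counting rows from `0`,
block `h` consists of the rows `r h, …, r (h + 1) - 1`. -/
structure BlockPartition (H m : ℕ) where
  r : Fin (H + 1) → ℕ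
  strictMono : StrictMono r
  r_zero : r 0 = 0
  r_last : r (Fin.last H) = m

namespace BlockPartition

variable {H m : ℕ}

/-- The number of rows of block `h`. -/
def size (p : BlockPartition H m) (h : Fin H) : ℕ := p.r h.succ - p.r h.castSucc

theorem size_pos (p : BlockPartition H m) (h : Fin H) : 0 < p.size h :=
  Nat.sub_pos_of_lt (p.strictMono Fin.castSucc_lt_succ)

/-- The first index inside block `h`. -/
def first (p : BlockPartition H m) (h : Fin H) : Fin (p.size h) := ⟨0, p.size_pos h⟩

/-- The matrix `I_h` that extracts the coordinates of block `h` from a vector of length `m`. -/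
noncomputable def proj (p : BlockPartition H m) (h : Fin H) :
    Matrix (Fin (p.size h)) (Fin m) ℂ :=
  Matrix.of fun i j => if (j : ℕ) = (i : ℕ) + p.r h.castSucc then 1 else 0

/-- The block diagonal matrix with diagonal blocks `Φ h`. -/
noncomputable def blockDiag (p : BlockPartition H m)
    (Φ : ∀ h, Matrix (Fin (p.size h)) (Fin (p.size h)) ℂ) : Matrix (Fin m) (Fin m) ℂ :=
  ∑ h, (p.proj h)ᵀ * Φ h * p.proj h

/-- The vector `(x 1ᵀ, …, x Hᵀ)ᵀ` of length `m` with blocks `x h`. -/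
noncomputable def stack (p : BlockPartition H m) (x : ∀ h, Fin (p.size h) → ℂ) : Fin m → ℂ :=
  ∑ h, (p.proj h)ᵀ *ᵥ x h

end BlockPartition

/-! ### Processes -/

section Processes

variable {Ω : Type*} [MeasurableSpace Ω]

/-- `(Z_t)` is an i.i.d. sequence of random vectors. -/
structure IsIID {d : ℕ} (Z : ℤ → Ω → (Fin d → ℂ)) (P : Measure Ω) : Prop where
  measurable : ∀ t, Measurable (Z t)
  indep : iIndepFun Z P
  identDistrib : ∀ s t, IdentDistrib (Z s) (Z t) P P

/-- `(Y_t)` is a sequence of random vectors all of whose finite dimensional distributions are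
shift invariant. -/
structure IsStrictlyStationary {m : ℕ} (Y : ℤ → Ω → (Fin m → ℂ)) (P : Measure Ω) : Prop where
  measurable : ∀ t, Measurable (Y t)
  map_shift : ∀ (n : ℕ) (t : Fin n → ℤ) (s : ℤ),
    P.map (fun ω i => Y (t i + s) ω) = P.map (fun ω i => Y (t i) ω)

/-- `Y` is a strictly stationary process satisfying
`Y_t - Ψ Y_{t-1} = ∑_{k=0}^q Θ_k Z_{t-k}` almost surely, for all `t`. -/
structure IsStrictSolution {m d q : ℕ} (P : Measure Ω) (Ψ : Matrix (Fin m) (Fin m) ℂ)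
    (Θ : Fin (q + 1) → Matrix (Fin m) (Fin d) ℂ) (Z : ℤ → Ω → (Fin d → ℂ))
    (Y : ℤ → Ω → (Fin m → ℂ)) : Prop where
  stationary : IsStrictlyStationary Y P
  equation : ∀ t : ℤ, ∀ᵐ ω ∂P,
    Y t ω - Ψ *ᵥ Y (t - 1) ω = ∑ k : Fin (q + 1), Θ k *ᵥ Z (t - (k : ℕ)) ω

/-- The probability space carries a uniform random variable on `[0,1)` that is independent of
`(Z_t)`. -/
def HasIndepUniform {d : ℕ} (P : Measure Ω) (Z : ℤ → Ω → (Fin d → ℂ)) : Prop :=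
  ∃ U : Ω → ℝ, Measurable U ∧ P.map U = volume.restrict (Set.Ico 0 1) ∧
    IndepFun U (fun ω t => Z t ω) P

end Processes

/-! ### The solution for a single block

Here `Φ` is a Jordan block and `B k` stands for `I_h S⁻¹ Θ_k`. -/

section Block

variable {Ω : Type*} {n d q : ℕ}

/-- `∑_{k=0}^q Φ^{q-k} B_k`. -/
noncomputable def momentMatrix (Φ : Matrix (Fin n) (Fin n) ℂ)
    (B : Fin (q + 1) → Matrix (Fin n) (Fin d) ℂ) : Matrix (Fin n) (Fin d) ℂ :=
  ∑ k : Fin (q + 1), Φ ^ (q - (k : ℕ)) * B k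

/-- `Φ^{j-q} (∑_{k=0}^{min(j,q)} Φ^{q-k} B_k) Z_{t-j}`. -/
noncomputable def pastTerm (Φ : Matrix (Fin n) (Fin n) ℂ)
    (B : Fin (q + 1) → Matrix (Fin n) (Fin d) ℂ) (Z : ℤ → Ω → (Fin d → ℂ))
    (t : ℤ) (j : ℕ) (ω : Ω) : Fin n → ℂ :=
  (Φ ^ ((j : ℤ) - (q : ℤ)) * ∑ k : Fin (q + 1) with k.val ≤ j, Φ ^ (q - (k : ℕ)) * B k) *ᵥ
    Z (t - j) ω

/-- `Φ^{-j-q} (∑_{k=max(1-j,0)}^q Φ^{q-k} B_k) Z_{t+j}`. -/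
noncomputable def futureTerm (Φ : Matrix (Fin n) (Fin n) ℂ)
    (B : Fin (q + 1) → Matrix (Fin n) (Fin d) ℂ) (Z : ℤ → Ω → (Fin d → ℂ))
    (t : ℤ) (j : ℤ) (ω : Ω) : Fin n → ℂ :=
  (Φ ^ (-j - (q : ℤ)) * ∑ k : Fin (q + 1) with 1 - j ≤ (k.val : ℤ), Φ ^ (q - (k : ℕ)) * B k) *ᵥ
    Z (t + j) ω

/-- `(∑_{k=0}^{min(j,q)} Φ^{j-k} B_k) Z_{t-j}`. -/
noncomputable def finiteTerm (Φ : Matrix (Fin n) (Fin n) ℂ)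
    (B : Fin (q + 1) → Matrix (Fin n) (Fin d) ℂ) (Z : ℤ → Ω → (Fin d → ℂ))
    (t : ℤ) (j : ℕ) (ω : Ω) : Fin n → ℂ :=
  (∑ k : Fin (q + 1) with k.val ≤ j, Φ ^ (j - (k : ℕ)) * B k) *ᵥ Z (t - j) ω

open Classical in
/-- The block process `X_t^{(h)}` for a block with eigenvalue `lam`. The last case is `1 < ‖lam‖`;
there the index `j` runs over the integers `j ≥ 1 - q`, written as `j = i + 1 - q` with
`i = 0, 1, 2, …`. -/
noncomputable def blockSolution (m : ℕ) (lam : ℂ) (B : Fin (q + 1) → Matrix (Fin n) (Fin d) ℂ)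
    (f : Fin n → ℂ) (Z : ℤ → Ω → (Fin d → ℂ)) (t : ℤ) (ω : Ω) : Fin n → ℂ :=
  if lam = 0 then ∑ j ∈ Finset.range (m + q), finiteTerm (jordanBlock n lam) B Z t j ω
  else if ‖lam‖ < 1 then ∑' j : ℕ, pastTerm (jordanBlock n lam) B Z t j ω
  else if ‖lam‖ = 1 then f + ∑ j ∈ Finset.range q, finiteTerm (jordanBlock n lam) B Z t j ω
  else -∑' i : ℕ, futureTerm (jordanBlock n lam) B Z t ((i : ℤ) + 1 - (q : ℤ)) ω

end Block

/-! ### Conditions and solution for the whole equation -/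

section Global

variable {Ω : Type*} [MeasurableSpace Ω] {H m d q : ℕ}

/-- `I_h S⁻¹ Θ_k`. -/
noncomputable def blockCoeff (p : BlockPartition H m) (S : Matrix (Fin m) (Fin m) ℂ)
    (Θ : Fin (q + 1) → Matrix (Fin m) (Fin d) ℂ) (h : Fin H) (k : Fin (q + 1)) :
    Matrix (Fin (p.size h)) (Fin d) ℂ :=
  p.proj h * S⁻¹ * Θ k

/-- The random vector `(∑_{k=0}^q Φ_h^{q-k} I_h S⁻¹ Θ_k) Z_0`. -/
noncomputable def blockVector (p : BlockPartition H m) (lam : Fin H → ℂ)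
    (S : Matrix (Fin m) (Fin m) ℂ) (Θ : Fin (q + 1) → Matrix (Fin m) (Fin d) ℂ)
    (Z : ℤ → Ω → (Fin d → ℂ)) (h : Fin H) (ω : Ω) : Fin (p.size h) → ℂ :=
  momentMatrix (jordanBlock (p.size h) (lam h)) (blockCoeff p S Θ h) *ᵥ Z 0 ω

/-- Conditions (i), (ii), (iii), with respect to the vector norms `N s` on `ℂ^s`. -/
structure Conditions (N : ∀ s : ℕ, Seminorm ℂ (Fin s → ℂ)) (P : Measure Ω)
    (p : BlockPartition H m) (lam : Fin H → ℂ)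
    (S : Matrix (Fin m) (Fin m) ℂ) (Θ : Fin (q + 1) → Matrix (Fin m) (Fin d) ℂ)
    (Z : ℤ → Ω → (Fin d → ℂ)) : Prop where
  log_moment : ∀ h, ‖lam h‖ ≠ 0 → ‖lam h‖ ≠ 1 →
    ∫⁻ ω, ENNReal.ofReal (Real.posLog (N _ (blockVector p lam S Θ Z h ω))) ∂P < ⊤
  constant : ∀ h, ‖lam h‖ = 1 → lam h ≠ 1 →
    ∃ α : Fin (p.size h) → ℂ, ∀ᵐ ω ∂P, blockVector p lam S Θ Z h ω = α
  constant_one : ∀ h, lam h = 1 →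
    ∃ α : Fin (p.size h) → ℂ, α (p.first h) = 0 ∧ ∀ᵐ ω ∂P, blockVector p lam S Θ Z h ω = α

/-- The process `Y_t = S (X_t^{(1)ᵀ}, …, X_t^{(H)ᵀ})ᵀ`. -/
noncomputable def solution (p : BlockPartition H m) (lam : Fin H → ℂ)
    (S : Matrix (Fin m) (Fin m) ℂ) (Θ : Fin (q + 1) → Matrix (Fin m) (Fin d) ℂ)
    (Z : ℤ → Ω → (Fin d → ℂ)) (f : ∀ h, Fin (p.size h) → ℂ) (t : ℤ) (ω : Ω) : Fin m → ℂ :=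
  S *ᵥ p.stack fun h => blockSolution m (lam h) (blockCoeff p S Θ h) (f h) Z t ω

end Global

end StrictARMA

namespace StrictARMA

/-! ### Growth of matrix powers -/

section Powers

variable {n : ℕ}

/-! Multiplication by `I_h S⁻¹` splits the equation into one equation X_t - Φ X_{t-1} = ∑ B_k
Z_{t-k} per Jordan block Φ with eigenvalue λ. Subtracting the finite sum `recentNoise` collapses the
moving average (`recentNoise_sub`): w = X - `recentNoise` satisfies w_t = Φ w_{t-1} + ξ_t with the
i.i.d. noise ξ_t = M Z_{t-q}, M being the `momentMatrix`. For necessity and uniqueness, only uniform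
tightness is retained from stationarity.

Necessity. In w_0 = ∑_{j<k} Φ^j ξ_{-j} + Φ^k w_{-k} the last term need not be independent of the
sum, since a solution may depend on future noise, and Φ^k may be unbounded when |λ| = 1. Instead (1
- (λR)^k)^{n+1}, with R the backward shift and n the block size, is applied to w at time 0
(`ae_sum_diffCoeff_smul_eq`). Nilpotency of Φ - λ cancels all remote values of w and leaves the same
sum plus noise from times ≤ -k, which is independent of it. For |λ| ≤ 1 the coefficients are
bounded, so these differences are tight uniformly in k. Hence, for small functionals L, ∏_{j<k}
|φ_ξ(L ∘ Φ^j)| ≥ 1/2 and ∑_{j<k} (1 - |φ_ξ(L ∘ Φ^j)|²) ≤ 2 for every k.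

Here |φ_ξ|² is the characteristic function of a symmetrized variable ξ - ξ'. If 0 < |λ| < 1, a
truncation inequality gives ∑_j P(‖Φ^j (ξ - ξ')‖ > c) < ∞, which is a logarithmic moment because
Φ^{-j} grows at most geometrically; |λ| > 1 follows by reversing time. If |λ| = 1, the summands tend
to 0 while Φ^j merely rotates the first coordinate that could be nonzero, so ξ - ξ' = 0 and ξ is a
constant α. For λ = 1 the first coordinate of w drifts linearly unless that of α vanishes.

Sufficiency. Logarithmic moments and Borel–Cantelli make the series converge, and the block
recursions are index shifts. The solution is a shift-equivariant function of Z, hence stationary.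

Uniqueness. A difference V of two solutions satisfies V_t = Φ V_{t-1} in each block; off the unit
circle, iterating forwards or backwards and using tightness gives V = 0. On the circle, λ^t e^{2πiU}
v can be added, with v an eigenvector and U the independent uniform variable. -/

theorem exists_norm_mulVec_le {m n : ℕ} (A : Matrix (Fin m) (Fin n) ℂ) :
    ∃ C : ℝ, 0 < C ∧ ∀ x, ‖A *ᵥ x‖ ≤ C * ‖x‖ := by
  obtain ⟨C, hC, h⟩ := (LinearMap.toContinuousLinearMap (Matrix.mulVecLin A)).bound
  exact ⟨C, hC, h⟩

/-- In the adapted norm g(x) = ∑ ε^{-l} ‖D^l x‖ with D = A - μ nilpotent, A = μ + D has norm at most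
|μ| + ε = ρ: the D-part shifts the sum by one index at the price of a factor ε. -/
theorem exists_norm_pow_mulVec_le {A : Matrix (Fin n) (Fin n) ℂ} {μ : ℂ} {N : ℕ} {ρ : ℝ}
    (hA : (A - μ • 1) ^ N = 0) (hρ : ‖μ‖ < ρ) :
    ∃ C : ℝ, 0 < C ∧ ∀ (j : ℕ) (x : Fin n → ℂ), ‖A ^ j *ᵥ x‖ ≤ C * ρ ^ j * ‖x‖ := by
  set D := A - μ • 1 with hD
  set ε := ρ - ‖μ‖ with hε
  have hε0 : 0 < ε := sub_pos.2 hρ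
  have hρ0 : 0 < ρ := (norm_nonneg μ).trans_lt hρ
  let g : (Fin n → ℂ) → ℝ := fun x => ∑ l ∈ Finset.range (N + 1), (ε⁻¹) ^ l * ‖D ^ l *ᵥ x‖
  have hcomm (l : ℕ) (x : Fin n → ℂ) :
      D ^ l *ᵥ (A *ᵥ x) = μ • (D ^ l *ᵥ x) + D ^ (l + 1) *ᵥ x := by
    have : A = μ • 1 + D := by rw [hD]; abel
    rw [pow_succ, this, Matrix.add_mulVec, Matrix.mulVec_add, Matrix.smul_mulVec,
      Matrix.mulVec_smul, Matrix.one_mulVec, Matrix.mulVec_mulVec]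
  have hstep (x : Fin n → ℂ) : g (A *ᵥ x) ≤ ρ * g x := by
    have h1 : g (A *ᵥ x) ≤ ∑ l ∈ Finset.range (N + 1),
        (‖μ‖ * ((ε⁻¹) ^ l * ‖D ^ l *ᵥ x‖) + ε * ((ε⁻¹) ^ (l + 1) * ‖D ^ (l + 1) *ᵥ x‖)) := by
      refine Finset.sum_le_sum fun l _ => ?_
      rw [hcomm]
      have h2 := norm_add_le (μ • (D ^ l *ᵥ x)) (D ^ (l + 1) *ᵥ x)
      rw [norm_smul] at h2
      have h3 : ε * ((ε⁻¹) ^ (l + 1) * ‖D ^ (l + 1) *ᵥ x‖) = (ε⁻¹) ^ l * ‖D ^ (l + 1) *ᵥ x‖ := by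
        rw [pow_succ]; field_simp
      rw [h3]
      have h4 : 0 ≤ (ε⁻¹) ^ l := by positivity
      nlinarith
    refine h1.trans ?_
    rw [Finset.sum_add_distrib, ← Finset.mul_sum, ← Finset.mul_sum]
    have h5 : ∑ l ∈ Finset.range (N + 1), (ε⁻¹) ^ (l + 1) * ‖D ^ (l + 1) *ᵥ x‖ ≤ g x := by
      have h6 := Finset.sum_range_succ' (fun l => (ε⁻¹) ^ l * ‖D ^ l *ᵥ x‖) (N + 1)
      have h7 : g x + (ε⁻¹) ^ (N + 1) * ‖D ^ (N + 1) *ᵥ x‖ = _ :=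
        (Finset.sum_range_succ (fun l => (ε⁻¹) ^ l * ‖D ^ l *ᵥ x‖) (N + 1)).symm.trans h6
      have h8 : D ^ (N + 1) = 0 := by rw [pow_succ, hA, zero_mul]
      rw [h8] at h7
      simp only [Matrix.zero_mulVec, norm_zero, mul_zero, add_zero] at h7
      rw [h7]
      have : 0 ≤ ε⁻¹ ^ 0 * ‖D ^ 0 *ᵥ x‖ := by positivity
      linarith
    have h9 : ρ * g x = ‖μ‖ * g x + ε * g x := by rw [hε]; ring
    rw [h9]
    have := mul_le_mul_of_nonneg_left h5 hε0.le
    linarith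
  have hiter (j : ℕ) (x : Fin n → ℂ) : g (A ^ j *ᵥ x) ≤ ρ ^ j * g x := by
    induction j with
    | zero => simp
    | succ j ih =>
      rw [pow_succ', ← Matrix.mulVec_mulVec]
      refine (hstep _).trans ?_
      rw [pow_succ', mul_assoc]
      exact mul_le_mul_of_nonneg_left ih hρ0.le
  have hge (x : Fin n → ℂ) : ‖x‖ ≤ g x := by
    have := Finset.single_le_sum (f := fun l => (ε⁻¹) ^ l * ‖D ^ l *ᵥ x‖)
      (fun l _ => by positivity) (Finset.mem_range.2 (Nat.succ_pos N))
    rw [pow_zero, pow_zero, one_mul, Matrix.one_mulVec] at this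
    exact this
  choose K hK0 hK using fun l => exists_norm_mulVec_le (D ^ l)
  refine ⟨∑ l ∈ Finset.range (N + 1), (ε⁻¹) ^ l * K l,
    Finset.sum_pos (fun l _ => mul_pos (by positivity) (hK0 l)) ⟨0, by simp⟩, fun j x => ?_⟩
  refine (hge _).trans ((hiter j x).trans ?_)
  rw [mul_comm _ (ρ ^ j), mul_assoc, Finset.sum_mul]
  refine mul_le_mul_of_nonneg_left (Finset.sum_le_sum fun l _ => ?_) (by positivity)
  rw [mul_assoc]
  exact mul_le_mul_of_nonneg_left (hK l x) (by positivity)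

/-- The inverse of a Jordan block is in general not a Jordan block, but it keeps a nilpotent part.
The estimates needed for inverses are therefore stated under the hypothesis `(A - μ • 1) ^ N = 0`.
Here A⁻¹ - μ⁻¹ is A - μ times a commuting factor. -/
theorem inv_sub_smul_one_pow_eq_zero {A : Matrix (Fin n) (Fin n) ℂ} {μ : ℂ} {N : ℕ}
    (hA : (A - μ • 1) ^ N = 0) (hu : IsUnit A) (hμ : μ ≠ 0) :
    (A⁻¹ - μ⁻¹ • (1 : Matrix (Fin n) (Fin n) ℂ)) ^ N = 0 := by
  have hdet := (Matrix.isUnit_iff_isUnit_det A).1 hu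
  have h : A⁻¹ - μ⁻¹ • (1 : Matrix (Fin n) (Fin n) ℂ) = (-μ⁻¹ • A⁻¹) * (A - μ • 1) := by
    rw [mul_sub, smul_mul_assoc, Matrix.nonsing_inv_mul A hdet, mul_smul_comm, mul_one,
      smul_smul]
    simp [hμ]
    abel
  have hc : Commute (-μ⁻¹ • A⁻¹) (A - μ • 1) := by
    refine Commute.smul_left (Commute.sub_right ?_ ?_) _
    · exact (Matrix.nonsing_inv_mul A hdet).trans (Matrix.mul_nonsing_inv A hdet).symm
    · exact (Commute.one_right _).smul_right _
  rw [h, hc.mul_pow, hA, mul_zero]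

/-- A - μ divides A^k - μ^k with a commuting cofactor, the geometric sum. -/
theorem pow_sub_smul_one_pow_eq_zero {A : Matrix (Fin n) (Fin n) ℂ} {μ : ℂ} {N : ℕ}
    (hA : (A - μ • 1) ^ N = 0) (k : ℕ) :
    (A ^ k - μ ^ k • (1 : Matrix (Fin n) (Fin n) ℂ)) ^ N = 0 := by
  have hc : Commute A (μ • (1 : Matrix (Fin n) (Fin n) ℂ)) := (Commute.one_right _).smul_right _
  have h : A ^ k - μ ^ k • (1 : Matrix (Fin n) (Fin n) ℂ) = A ^ k - (μ • 1) ^ k := by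
    rw [smul_pow, one_pow]
  have hg := hc.mul_geom_sum₂ k
  rw [h, ← hg, Commute.mul_pow, hA, zero_mul]
  refine Commute.sum_right _ _ _ fun i _ => ?_
  exact (((Commute.refl A).sub_left hc.symm).pow_right _).mul_right
    ((hc.sub_left (Commute.refl _)).pow_right _)

end Powers

/-! ### Jordan blocks -/

section Jordan

variable {n : ℕ}

theorem jordanBlock_mulVec (lam : ℂ) (x : Fin n → ℂ) (i : Fin n) :
    (jordanBlock n lam *ᵥ x) i =
      lam * x i + if h : 0 < (i : ℕ) then x ⟨i - 1, by omega⟩ else 0 := by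
  have h1 : ∀ j : Fin n, jordanBlock n lam i j * x j =
      (if j = i then lam * x j else 0) + if (i : ℕ) = j + 1 then x j else 0 := by
    intro j
    simp only [jordanBlock, Matrix.of_apply]
    by_cases h : i = j
    · subst h; simp
    · rw [if_neg h, if_neg (Ne.symm h)]
      split_ifs <;> simp
  simp only [Matrix.mulVec, dotProduct]
  rw [Finset.sum_congr rfl fun j _ => h1 j, Finset.sum_add_distrib, Finset.sum_ite_eq']
  simp only [Finset.mem_univ, if_true]
  congr 1
  split_ifs with h
  · rw [Finset.sum_eq_single ⟨i - 1, by omega⟩]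
    · rw [if_pos]; simp; omega
    · intro j _ hj
      rw [if_neg]
      intro h2
      apply hj
      ext; simp; omega
    · simp
  · exact Finset.sum_eq_zero fun j _ => if_neg (by omega)

theorem jordanBlock_sub_smul_one (lam : ℂ) : jordanBlock n lam - lam • 1 = jordanBlock n 0 := by
  ext i j
  simp only [jordanBlock, Matrix.sub_apply, Matrix.smul_apply, Matrix.one_apply, Matrix.of_apply]
  split_ifs <;> simp

theorem jordanBlock_zero_pow_apply_eq_zero (k : ℕ) (i j : Fin n) (h : (i : ℕ) < j + k) :
    (jordanBlock n 0 ^ k) i j = 0 := by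
  induction k generalizing i with
  | zero =>
    rw [pow_zero, Matrix.one_apply_ne]
    rintro rfl
    omega
  | succ k ih =>
    rw [pow_succ', Matrix.mul_apply]
    refine Finset.sum_eq_zero fun l _ => ?_
    by_cases hl : (i : ℕ) = l + 1
    · rw [ih l (by omega), mul_zero]
    · simp [jordanBlock, hl]

theorem jordanBlock_sub_smul_one_pow (lam : ℂ) : (jordanBlock n lam - lam • 1) ^ n = 0 := by
  rw [jordanBlock_sub_smul_one]
  ext i j
  rw [jordanBlock_zero_pow_apply_eq_zero n i j (by omega), Matrix.zero_apply]

theorem jordanBlock_zero_pow {k : ℕ} (h : n ≤ k) : jordanBlock n 0 ^ k = 0 := by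
  ext i j
  rw [jordanBlock_zero_pow_apply_eq_zero k i j (by omega), Matrix.zero_apply]

theorem isUnit_jordanBlock {lam : ℂ} (h : lam ≠ 0) : IsUnit (jordanBlock n lam) := by
  rw [Matrix.isUnit_iff_isUnit_det, Matrix.det_of_isLowerTriangular]
  · simp [jordanBlock, h]
  · intro i j hij
    have hij' : i < j := hij
    have h1 : i ≠ j := hij'.ne
    have h2 : ¬ (i : ℕ) = j + 1 := by have := Fin.lt_def.1 hij'; omega
    simp [jordanBlock, h1, h2]

theorem isUnit_one_sub_jordanBlock {lam : ℂ} (h : lam ≠ 1) :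
    IsUnit (1 - jordanBlock n lam) := by
  rw [Matrix.isUnit_iff_isUnit_det, Matrix.det_of_isLowerTriangular]
  · simp [jordanBlock, sub_eq_zero, h.symm]
  · intro i j hij
    have hij' : i < j := hij
    have h1 : i ≠ j := hij'.ne
    have h2 : ¬ (i : ℕ) = j + 1 := by have := Fin.lt_def.1 hij'; omega
    simp [jordanBlock, h1, h2]

theorem exists_one_sub_jordanBlock_one_mulVec_eq (α : Fin n → ℂ)
    (h : ∀ i : Fin n, (i : ℕ) = 0 → α i = 0) : ∃ f, (1 - jordanBlock n 1) *ᵥ f = α := by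
  -- Since 1 - J is minus the downward shift, coordinate i of the equation reads -f_{i-1} = α_i. The
  -- last coordinate of f is free and set to 0.
  refine ⟨fun i => if hi : (i : ℕ) + 1 < n then -α ⟨i + 1, hi⟩ else 0, ?_⟩
  ext i
  rw [Matrix.sub_mulVec, Matrix.one_mulVec, Pi.sub_apply, jordanBlock_mulVec]
  by_cases hi : 0 < (i : ℕ)
  · have h1 : (i : ℕ) - 1 + 1 = i := by omega
    simp [hi, h1]
  · simp [hi, h i (by omega)]

/-- By lower triangularity, coordinate i is fed only by coordinates up to i. This lets the
unit-modulus case proceed one coordinate at a time. -/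
theorem jordanBlock_pow_mulVec (lam : ℂ) (x : Fin n → ℂ) (i : Fin n) (h : ∀ l < i, x l = 0)
    (j : ℕ) : (jordanBlock n lam ^ j *ᵥ x) i = lam ^ j * x i := by
  -- The vanishing of the earlier coordinates has to be carried through the induction as well.
  have key : (∀ l < i, (jordanBlock n lam ^ j *ᵥ x) l = 0) ∧
      (jordanBlock n lam ^ j *ᵥ x) i = lam ^ j * x i := by
    induction j with
    | zero => simpa using h
    | succ j ih =>
      rw [pow_succ', ← Matrix.mulVec_mulVec]
      have hz : ∀ l ≤ i, ∀ hl : 0 < (l : ℕ),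
          (jordanBlock n lam ^ j *ᵥ x) ⟨l - 1, by omega⟩ = 0 := by
        intro l hl h0
        apply ih.1
        rw [Fin.lt_def]
        have := Fin.le_def.1 hl
        simp; omega
      constructor
      · intro l hl
        rw [jordanBlock_mulVec, ih.1 l hl]
        split_ifs with h0
        · rw [hz l hl.le h0]; simp
        · simp
      · rw [jordanBlock_mulVec, ih.2]
        split_ifs with h0
        · rw [hz i le_rfl h0]; ring
        · ring
  exact key.2

theorem jordanBlock_mulVec_single_last (hn : 0 < n) (lam : ℂ) :
    jordanBlock n lam *ᵥ Pi.single (⟨n - 1, by omega⟩ : Fin n) (1 : ℂ) =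
      lam • Pi.single (⟨n - 1, by omega⟩ : Fin n) (1 : ℂ) := by
  ext i
  rw [jordanBlock_mulVec, Pi.smul_apply, smul_eq_mul]
  have : (if h : 0 < (i : ℕ) then
      (Pi.single (⟨n - 1, by omega⟩ : Fin n) (1 : ℂ) : Fin n → ℂ) ⟨i - 1, by omega⟩ else 0) = 0 := by
    split_ifs with h
    · rw [Pi.single_eq_of_ne]
      intro h2
      have := congrArg Fin.val h2
      simp at this
      omega
    · rfl
  rw [this, add_zero]

end Jordan

/-! ### Block partitions -/

namespace BlockPartition

variable {H m : ℕ} (p : BlockPartition H m)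

theorem size_add (h : Fin H) : p.size h + p.r h.castSucc = p.r h.succ :=
  Nat.sub_add_cancel (p.strictMono Fin.castSucc_lt_succ).le

theorem size_le (h : Fin H) : p.size h ≤ m := by
  have h1 := p.size_add h
  have h2 := p.strictMono.monotone (Fin.le_last h.succ)
  rw [p.r_last] at h2
  omega

theorem succ_le_of_lt {h h' : Fin H} (hlt : h < h') : p.r h.succ ≤ p.r h'.castSucc :=
  p.strictMono.monotone (Fin.le_def.2 (Nat.succ_le_of_lt (Fin.lt_def.1 hlt)))

theorem proj_mul_transpose_self (h : Fin H) : p.proj h * (p.proj h)ᵀ = 1 := by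
  ext i j
  have hi := p.size_add h
  have h2 := p.strictMono.monotone (Fin.le_last h.succ)
  rw [p.r_last] at h2
  rw [Matrix.mul_apply, Finset.sum_eq_single (⟨i + p.r h.castSucc, by omega⟩ : Fin m)]
  · simp only [proj, Matrix.of_apply, Matrix.transpose_apply, if_true, one_mul, Matrix.one_apply]
    refine if_congr ?_ rfl rfl
    rw [Fin.ext_iff, Nat.add_right_cancel_iff]
  · intro l _ hl
    have : ¬ (l : ℕ) = i + p.r h.castSucc := fun h3 => hl (Fin.ext h3)
    simp [proj, this]
  · simp

theorem proj_mul_transpose_of_ne {h h' : Fin H} (hne : h ≠ h') :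
    p.proj h * (p.proj h')ᵀ = 0 := by
  ext i j
  rw [Matrix.mul_apply, Matrix.zero_apply]
  refine Finset.sum_eq_zero fun l _ => ?_
  simp only [proj, Matrix.of_apply, Matrix.transpose_apply]
  by_cases h1 : (l : ℕ) = i + p.r h.castSucc
  · rw [if_neg (_ : ¬ (l : ℕ) = j + p.r h'.castSucc), mul_zero]
    intro h2
    have hi := p.size_add h
    have hi' := p.size_add h'
    rcases lt_or_gt_of_ne hne with hlt | hlt <;> have := p.succ_le_of_lt hlt <;> omega
  · rw [if_neg h1, zero_mul]

theorem exists_mem_block (l : Fin m) :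
    ∃ h : Fin H, p.r h.castSucc ≤ l ∧ (l : ℕ) < p.r h.succ := by
  by_contra! hcon
  have : ∀ k : Fin (H + 1), p.r k ≤ l := by
    intro k
    induction k using Fin.induction with
    | zero => rw [p.r_zero]; exact Nat.zero_le _
    | succ k ih => exact hcon k ih
  have h1 := this (Fin.last H)
  rw [p.r_last] at h1
  omega

theorem proj_mulVec_apply (h : Fin H) (x : Fin m → ℂ) (i : Fin (p.size h)) (l : Fin m)
    (hl : (l : ℕ) = i + p.r h.castSucc) : (p.proj h *ᵥ x) i = x l := by
  rw [Matrix.mulVec, dotProduct, Finset.sum_eq_single l]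
  · simp [proj, hl]
  · intro l' _ hl'
    have : ¬ (l' : ℕ) = i + p.r h.castSucc := fun h3 => hl' (Fin.ext (h3.trans hl.symm))
    simp [proj, this]
  · simp

theorem ext_proj {x y : Fin m → ℂ} (hxy : ∀ h, p.proj h *ᵥ x = p.proj h *ᵥ y) : x = y := by
  ext l
  obtain ⟨h, h1, h2⟩ := p.exists_mem_block l
  have h3 := p.size_add h
  have h4 := congrFun (hxy h) ⟨l - p.r h.castSucc, by omega⟩
  rwa [p.proj_mulVec_apply h x _ l (by simp; omega),
    p.proj_mulVec_apply h y _ l (by simp; omega)] at h4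

theorem proj_stack (x : ∀ h, Fin (p.size h) → ℂ) (h : Fin H) : p.proj h *ᵥ p.stack x = x h := by
  rw [stack, Matrix.mulVec_sum, Finset.sum_eq_single h]
  · rw [Matrix.mulVec_mulVec, p.proj_mul_transpose_self, Matrix.one_mulVec]
  · intro h' _ hne
    rw [Matrix.mulVec_mulVec, p.proj_mul_transpose_of_ne hne.symm, Matrix.zero_mulVec]
  · simp

theorem proj_mul_blockDiag (Φ : ∀ h, Matrix (Fin (p.size h)) (Fin (p.size h)) ℂ) (h : Fin H) :
    p.proj h * p.blockDiag Φ = Φ h * p.proj h := by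
  rw [blockDiag, Matrix.mul_sum, Finset.sum_eq_single h]
  · rw [← Matrix.mul_assoc, ← Matrix.mul_assoc, p.proj_mul_transpose_self, Matrix.one_mul]
  · intro h' _ hne
    rw [← Matrix.mul_assoc, ← Matrix.mul_assoc, p.proj_mul_transpose_of_ne hne.symm,
      Matrix.zero_mul, Matrix.zero_mul]
  · simp

end BlockPartition

/-! ### Reduction of the moving average part -/

section Reduction

variable {Ω : Type*} {n d q : ℕ}

/-- The coefficient `∑_{k=0}^{min(j,q)} A^{j-k} B_k` of `Z_{t-j}`. -/
noncomputable def noiseCoeff (A : Matrix (Fin n) (Fin n) ℂ)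
    (B : Fin (q + 1) → Matrix (Fin n) (Fin d) ℂ) (j : ℕ) : Matrix (Fin n) (Fin d) ℂ :=
  ∑ k : Fin (q + 1) with k.val ≤ j, A ^ (j - (k : ℕ)) * B k

theorem finiteTerm_eq (A : Matrix (Fin n) (Fin n) ℂ)
    (B : Fin (q + 1) → Matrix (Fin n) (Fin d) ℂ) (Z : ℤ → Ω → (Fin d → ℂ))
    (t : ℤ) (j : ℕ) (ω : Ω) : finiteTerm A B Z t j ω = noiseCoeff A B j *ᵥ Z (t - j) ω := rfl

variable (A : Matrix (Fin n) (Fin n) ℂ) (B : Fin (q + 1) → Matrix (Fin n) (Fin d) ℂ)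

theorem noiseCoeff_zero : noiseCoeff A B 0 = B 0 := by
  rw [noiseCoeff, Finset.sum_eq_single 0]
  · simp
  · intro k hk hk0
    exact absurd (Fin.ext (Nat.le_zero.1 (Finset.mem_filter.1 hk).2)) hk0
  · simp

theorem noiseCoeff_succ (j : ℕ) : noiseCoeff A B (j + 1) =
    A * noiseCoeff A B j + if h : j + 1 < q + 1 then B ⟨j + 1, h⟩ else 0 := by
  simp only [noiseCoeff, Matrix.mul_sum, Finset.sum_filter]
  have : (if h : j + 1 < q + 1 then B ⟨j + 1, h⟩ else 0) =
      ∑ k : Fin (q + 1), if (k : ℕ) = j + 1 then B k else 0 := by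
    split_ifs with h
    · rw [Finset.sum_eq_single ⟨j + 1, h⟩]
      · simp
      · intro k _ hk
        exact if_neg fun h2 => hk (Fin.ext h2)
      · simp
    · exact (Finset.sum_eq_zero fun k _ => if_neg (by omega)).symm
  rw [this, ← Finset.sum_add_distrib]
  refine Finset.sum_congr rfl fun k _ => ?_
  rcases lt_trichotomy (k : ℕ) (j + 1) with h | h | h
  · rw [if_pos h.le, if_pos (by omega), if_neg h.ne, add_zero, ← Matrix.mul_assoc, ← pow_succ',
      ← Nat.sub_add_comm (by omega)]
  · rw [if_pos h.le, if_neg (by omega), if_pos h, h]; simp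
  · rw [if_neg (by omega), if_neg (by omega), if_neg (by omega), Matrix.mul_zero, add_zero]

theorem noiseCoeff_order : noiseCoeff A B q = momentMatrix A B := by
  rw [noiseCoeff, momentMatrix, Finset.filter_true_of_mem]
  intro k _; omega

theorem noiseCoeff_add (i : ℕ) : noiseCoeff A B (q + i) = A ^ i * momentMatrix A B := by
  induction i with
  | zero => simp [noiseCoeff_order]
  | succ i ih =>
    rw [← add_assoc, noiseCoeff_succ, ih, dif_neg (by omega), pow_succ', Matrix.mul_assoc, add_zero]

/-- The part of a solution that involves `Z_t, …, Z_{t-q+1}`. -/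
noncomputable def recentNoise (Z : ℤ → Ω → (Fin d → ℂ)) (t : ℤ) (ω : Ω) : Fin n → ℂ :=
  ∑ j ∈ Finset.range q, finiteTerm A B Z t j ω

/-- The recursion `noiseCoeff_succ` makes the left side telescope, leaving one boundary term at lag
q. -/
theorem recentNoise_sub (Z : ℤ → Ω → (Fin d → ℂ)) (t : ℤ) (ω : Ω) :
    recentNoise A B Z t ω - A *ᵥ recentNoise A B Z (t - 1) ω =
      ∑ k : Fin (q + 1), B k *ᵥ Z (t - (k : ℕ)) ω - momentMatrix A B *ᵥ Z (t - q) ω := by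
  -- Induction on a truncation level N: the boundary term at lag N is absorbed by the next summand.
  have key : ∀ N ≤ q, ∑ j ∈ Finset.range N, finiteTerm A B Z t j ω -
      A *ᵥ ∑ j ∈ Finset.range N, finiteTerm A B Z (t - 1) j ω =
      ∑ k : Fin (q + 1) with k.val ≤ N, B k *ᵥ Z (t - (k : ℕ)) ω -
        noiseCoeff A B N *ᵥ Z (t - N) ω := by
    intro N
    induction N with
    | zero =>
      intro _
      have h0 : (Finset.univ.filter fun k : Fin (q + 1) => k.val ≤ 0) = {0} := by
        ext k
        rw [Finset.mem_filter, Finset.mem_singleton, Fin.ext_iff, Fin.val_zero, Nat.le_zero]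
        exact and_iff_right (Finset.mem_univ k)
      rw [h0, Finset.sum_singleton, noiseCoeff_zero, Finset.range_zero, Finset.sum_empty,
        Finset.sum_empty, Matrix.mulVec_zero, sub_zero, Fin.val_zero, sub_self]
    | succ N ih =>
      intro hN
      have h1 := ih (by omega)
      rw [Finset.sum_range_succ, Finset.sum_range_succ, Matrix.mulVec_add, finiteTerm_eq,
        finiteTerm_eq, noiseCoeff_succ, dif_pos (by omega), Matrix.add_mulVec]
      have h2 : (Finset.univ.filter fun k : Fin (q + 1) => k.val ≤ N + 1) =
          insert ⟨N + 1, by omega⟩ (Finset.univ.filter fun k : Fin (q + 1) => k.val ≤ N) := by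
        ext k
        simp only [Finset.mem_filter, Finset.mem_univ, true_and, Finset.mem_insert, Fin.ext_iff]
        omega
      rw [h2, Finset.sum_insert (by simp)]
      have h3 : t - 1 - (N : ℤ) = t - ((N + 1 : ℕ) : ℤ) := by push_cast; ring
      rw [h3, Matrix.mulVec_mulVec]
      rw [sub_eq_iff_eq_add] at h1
      rw [h1]
      abel
  have h := key q le_rfl
  rw [Finset.filter_true_of_mem (fun k _ => by omega), noiseCoeff_order] at h
  exact h

end Reduction

/-! ### Uniform tightness -/

section Tight

open scoped ENNReal NNReal

variable {Ω ι E F : Type*} [MeasurableSpace Ω] [NormedAddCommGroup E] [NormedAddCommGroup F]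

/-- Uniform tightness of a family of random vectors, in terms of truncated first moments. -/
def UniformlyTight (w : ι → Ω → E) (P : Measure Ω) : Prop :=
  ∀ ε : ℝ≥0∞, 0 < ε → ∃ δ : ℝ≥0, 0 < δ ∧ ∀ t, ∫⁻ ω, min 1 (δ * ‖w t ω‖ₑ) ∂P ≤ ε

variable {P : Measure Ω}

theorem exists_lintegral_min_le [MeasurableSpace E] [OpensMeasurableSpace E]
    [IsFiniteMeasure P] {X : Ω → E} (hX : AEMeasurable X P) {ε : ℝ≥0∞} (hε : 0 < ε) :
    ∃ δ : ℝ≥0, 0 < δ ∧ ∫⁻ ω, min 1 (δ * ‖X ω‖ₑ) ∂P ≤ ε := by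
  have hlim : Filter.Tendsto (fun k : ℕ => ∫⁻ ω, min 1 ((((k : ℝ≥0) + 1)⁻¹ : ℝ≥0) * ‖X ω‖ₑ) ∂P)
      Filter.atTop (nhds (∫⁻ _, 0 ∂P)) := by
    refine tendsto_lintegral_of_dominated_convergence' (fun _ => 1) (fun k => ?_)
      (fun k => Filter.Eventually.of_forall fun ω => min_le_left _ _) (by simp)
      (Filter.Eventually.of_forall fun ω => ?_)
    · exact (aemeasurable_const.min (aemeasurable_const.mul hX.enorm))
    · have h1 : Filter.Tendsto (fun k : ℕ => ((((k : ℝ≥0) + 1)⁻¹ : ℝ≥0) : ℝ≥0∞) * ‖X ω‖ₑ)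
          Filter.atTop (nhds (((0 : ℝ≥0) : ℝ≥0∞) * ‖X ω‖ₑ)) := by
        refine ENNReal.Tendsto.mul_const (ENNReal.tendsto_coe.2 ?_) (Or.inr enorm_ne_top)
        have := tendsto_one_div_add_atTop_nhds_zero_nat (𝕜 := ℝ)
        rw [← NNReal.tendsto_coe]
        simpa using this
      simpa using tendsto_const_nhds (x := (1 : ℝ≥0∞)).min h1
  rw [lintegral_zero] at hlim
  obtain ⟨k, hk⟩ := ((tendsto_order.1 hlim).2 ε hε).exists
  exact ⟨_, by positivity, hk.le⟩

theorem UniformlyTight.of_identDistrib [MeasurableSpace E] [OpensMeasurableSpace E]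
    [IsFiniteMeasure P] {w : ι → Ω → E} (h : ∀ s t, IdentDistrib (w s) (w t) P P) :
    UniformlyTight w P := by
  intro ε hε
  rcases isEmpty_or_nonempty ι with hι | ⟨⟨t₀⟩⟩
  · exact ⟨1, one_pos, fun t => (IsEmpty.false t).elim⟩
  obtain ⟨δ, hδ, hle⟩ := exists_lintegral_min_le (h t₀ t₀).aemeasurable_fst hε
  refine ⟨δ, hδ, fun t => ?_⟩
  have hm : Measurable fun x : E => min 1 ((δ : ℝ≥0∞) * ‖x‖ₑ) :=
    measurable_const.min (measurable_enorm.const_mul _)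
  exact ((h t t₀).comp hm).lintegral_eq.trans_le hle

/-- The reindexing `a` covers subfamilies, time reversal and families indexed by the step length of
a difference. -/
theorem UniformlyTight.of_norm_le {κ : Type*} {w : ι → Ω → E} (h : UniformlyTight w P)
    {v : κ → Ω → F} (a : κ → ι) {C : ℝ}
    (hv : ∀ t, ∀ᵐ ω ∂P, ‖v t ω‖ ≤ C * ‖w (a t) ω‖) : UniformlyTight v P := by
  intro ε hε
  obtain ⟨δ, hδ, hle⟩ := h ε hε
  -- The maximum with 1 permits division by K even if C ≤ 0.
  set K : ℝ≥0 := max 1 C.toNNReal with hK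
  have hK1 : 0 < K := lt_of_lt_of_le one_pos (le_max_left _ _)
  refine ⟨δ / K, div_pos hδ hK1, fun t => (lintegral_mono_ae ?_).trans (hle (a t))⟩
  filter_upwards [hv t] with ω hω
  refine min_le_min le_rfl ?_
  have h1 : ‖v t ω‖₊ ≤ K * ‖w (a t) ω‖₊ := by
    rw [← NNReal.coe_le_coe]
    push_cast
    refine hω.trans (mul_le_mul_of_nonneg_right ?_ (norm_nonneg _))
    exact (Real.le_coe_toNNReal C).trans (by rw [hK]; exact_mod_cast le_max_right _ _)
  rw [enorm_eq_nnnorm, enorm_eq_nnnorm, ← ENNReal.coe_mul, ← ENNReal.coe_mul, ENNReal.coe_le_coe]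
  calc δ / K * ‖v t ω‖₊ ≤ δ / K * (K * ‖w (a t) ω‖₊) := mul_le_mul_right h1 _
    _ = δ * ‖w (a t) ω‖₊ := by rw [← mul_assoc, div_mul_cancel₀ _ hK1.ne']

theorem UniformlyTight.comp {κ : Type*} {w : ι → Ω → E} (h : UniformlyTight w P) (a : κ → ι) :
    UniformlyTight (fun t => w (a t)) P :=
  h.of_norm_le a (C := 1) fun t => Filter.Eventually.of_forall fun ω => by simp

theorem UniformlyTight.congr {w v : ι → Ω → E} (h : UniformlyTight w P)
    (hv : ∀ t, v t =ᵐ[P] w t) : UniformlyTight v P :=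
  h.of_norm_le id (C := 1) fun t => (hv t).mono fun ω hω => by simp [hω]

theorem UniformlyTight.add [MeasurableSpace E] [OpensMeasurableSpace E] {w v : ι → Ω → E}
    (hw : UniformlyTight w P) (hv : UniformlyTight v P) (hm : ∀ t, AEMeasurable (w t) P) :
    UniformlyTight (fun t ω => w t ω + v t ω) P := by
  intro ε hε
  obtain ⟨δ, hδ, hδ'⟩ := hw (ε / 2) (ENNReal.half_pos hε.ne')
  obtain ⟨η, hη, hη'⟩ := hv (ε / 2) (ENNReal.half_pos hε.ne')
  refine ⟨min δ η, lt_min hδ hη, fun t => ?_⟩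
  calc ∫⁻ ω, min 1 ((min δ η : ℝ≥0) * ‖w t ω + v t ω‖ₑ) ∂P
      ≤ ∫⁻ ω, min 1 (δ * ‖w t ω‖ₑ) + min 1 (η * ‖v t ω‖ₑ) ∂P := by
        refine lintegral_mono fun ω => ?_
        have h1 : ((min δ η : ℝ≥0) : ℝ≥0∞) * ‖w t ω + v t ω‖ₑ ≤ δ * ‖w t ω‖ₑ + η * ‖v t ω‖ₑ := by
          refine (mul_le_mul_right (enorm_add_le _ _) _).trans ?_
          rw [mul_add]
          exact add_le_add
            (mul_le_mul_left (ENNReal.coe_le_coe.2 (min_le_left _ _)) _)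
            (mul_le_mul_left (ENNReal.coe_le_coe.2 (min_le_right _ _)) _)
        rcases le_total 1 (δ * ‖w t ω‖ₑ : ℝ≥0∞) with h | h
        · rw [min_eq_left h]; exact (min_le_left _ _).trans le_self_add
        rcases le_total 1 (η * ‖v t ω‖ₑ : ℝ≥0∞) with h' | h'
        · rw [min_eq_left h']; exact (min_le_left _ _).trans le_add_self
        · rw [min_eq_right h, min_eq_right h']; exact (min_le_right _ _).trans h1
    _ = ∫⁻ ω, min 1 (δ * ‖w t ω‖ₑ) ∂P + ∫⁻ ω, min 1 (η * ‖v t ω‖ₑ) ∂P :=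
        lintegral_add_left' (aemeasurable_const.min ((hm t).enorm.const_mul _)) _
    _ ≤ ε / 2 + ε / 2 := add_le_add (hδ' t) (hη' t)
    _ = ε := ENNReal.add_halves ε

theorem UniformlyTight.sub [MeasurableSpace E] [OpensMeasurableSpace E] {w v : ι → Ω → E}
    (hw : UniformlyTight w P) (hv : UniformlyTight v P) (hm : ∀ t, AEMeasurable (w t) P) :
    UniformlyTight (fun t ω => w t ω - v t ω) P := by
  have hn : UniformlyTight (fun t ω => -v t ω) P :=
    hv.of_norm_le id (C := 1) fun t => Filter.Eventually.of_forall fun ω => by simp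
  simpa only [sub_eq_add_neg] using hw.add hn hm

theorem UniformlyTight.zero : UniformlyTight (fun (_ : ι) (_ : Ω) => (0 : E)) P :=
  fun ε _ => ⟨1, one_pos, fun t => by simp⟩

theorem UniformlyTight.sum [MeasurableSpace E] [BorelSpace E] [SecondCountableTopology E]
    {κ : Type*} (s : Finset κ) {w : κ → ι → Ω → E}
    (hw : ∀ l ∈ s, UniformlyTight (w l) P) (hm : ∀ l ∈ s, ∀ t, AEMeasurable (w l t) P) :
    UniformlyTight (fun t ω => ∑ l ∈ s, w l t ω) P := by
  classical
  induction s using Finset.induction_on with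
  | empty => simpa using UniformlyTight.zero
  | insert a s ha ih =>
    simp only [Finset.sum_insert ha]
    exact (hw a (Finset.mem_insert_self _ _)).add
      (ih (fun l hl => hw l (Finset.mem_insert_of_mem hl))
        (fun l hl => hm l (Finset.mem_insert_of_mem hl)))
      (hm a (Finset.mem_insert_self _ _))

/-- Tightness makes C_k ‖w_{a k}‖ tend to 0 in probability, while V does not depend on k; so E
min(1, ‖V‖) = 0. -/
theorem UniformlyTight.ae_eq_zero [MeasurableSpace E] [OpensMeasurableSpace E]
    {w : ι → Ω → E} (h : UniformlyTight w P) {V : Ω → E} (hV : AEMeasurable V P)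
    {C : ℕ → ℝ} (hC : Filter.Tendsto C Filter.atTop (nhds 0)) (a : ℕ → ι)
    (hle : ∀ k, ∀ᵐ ω ∂P, ‖V ω‖ ≤ C k * ‖w (a k) ω‖) : V =ᵐ[P] 0 := by
  have hz : ∫⁻ ω, min 1 ‖V ω‖ₑ ∂P = 0 := by
    refine le_antisymm (le_of_forall_pos_le_add fun ε hε => ?_) zero_le
    rw [zero_add]
    obtain ⟨δ, hδ, hδ'⟩ := h ε hε
    obtain ⟨k, hk⟩ := ((tendsto_order.1 hC).2 (δ : ℝ) (by exact_mod_cast hδ)).exists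
    refine (lintegral_mono_ae ?_).trans (hδ' (a k))
    filter_upwards [hle k] with ω hω
    refine min_le_min le_rfl ?_
    rw [enorm_eq_nnnorm, enorm_eq_nnnorm, ← ENNReal.coe_mul, ENNReal.coe_le_coe,
      ← NNReal.coe_le_coe]
    push_cast
    exact hω.trans (mul_le_mul_of_nonneg_right hk.le (norm_nonneg _))
  rw [lintegral_eq_zero_iff' (aemeasurable_const.min hV.enorm)] at hz
  filter_upwards [hz] with ω hω
  have : ‖V ω‖ₑ = 0 := by
    rcases min_choice (1 : ℝ≥0∞) ‖V ω‖ₑ with h1 | h1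
    · exact absurd (h1.symm.trans hω) one_ne_zero
    · exact h1.symm.trans hω
  simpa using this

/-- If α ≠ 0, some kα has size at least 1/δ, and its truncated moment is 1. -/
theorem UniformlyTight.eq_zero_of_nsmul [IsProbabilityMeasure P] [NormedSpace ℝ E]
    {w : ℕ → Ω → E} (h : UniformlyTight w P) {α : E}
    (hα : ∀ k, ∀ᵐ ω ∂P, w k ω = (k : ℝ) • α) : α = 0 := by
  by_contra hne
  obtain ⟨δ, hδ, hδ'⟩ := h (1 / 2) (by simp)
  have hpos : 0 < δ * ‖α‖₊ := mul_pos hδ (nnnorm_pos.2 hne)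
  obtain ⟨k, hk⟩ := exists_nat_gt (δ * ‖α‖₊)⁻¹
  have h1 : ∫⁻ ω, min 1 (δ * ‖w k ω‖ₑ) ∂P = 1 := by
    rw [lintegral_congr_ae (g := fun _ => 1)]
    · simp
    · filter_upwards [hα k] with ω hω
      rw [hω, enorm_smul]
      refine min_eq_left ?_
      rw [enorm_eq_nnnorm, enorm_eq_nnnorm, ← ENNReal.coe_mul, ← ENNReal.coe_mul,
        ← ENNReal.coe_one, ENNReal.coe_le_coe]
      have h2 : ‖(k : ℝ)‖₊ = k := by simp
      rw [h2, mul_left_comm]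
      have := mul_le_mul_left hk.le (δ * ‖α‖₊)
      rwa [inv_mul_cancel₀ hpos.ne'] at this
  have h3 := hδ' k
  rw [h1] at h3
  have h4 : (1 / 2 : ℝ≥0∞) < 1 := by simp
  exact absurd h3 (not_le.2 h4)

/-- From |e^{ix} - 1| ≤ min(2, |x|), |φ(L) - 1| is at most twice the truncated moment; tightness at
level 1/4 yields 1/2. -/
theorem UniformlyTight.half_le_norm_charFunDual [IsProbabilityMeasure P] [NormedSpace ℝ E]
    [MeasurableSpace E] [BorelSpace E] {w : ι → Ω → E} (h : UniformlyTight w P)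
    (hm : ∀ t, AEMeasurable (w t) P) :
    ∃ δ : ℝ, 0 < δ ∧ ∀ L : StrongDual ℝ E, ‖L‖ ≤ δ → ∀ t, 1 / 2 ≤ ‖charFunDual (P.map (w t)) L‖ := by
  obtain ⟨δ, hδ, hδ'⟩ := h (1 / 4) (by simp)
  refine ⟨δ, by exact_mod_cast hδ, fun L hL t => ?_⟩
  have hint : Integrable (fun ω => Complex.exp (L (w t ω) * Complex.I)) P := by
    refine Integrable.of_bound (C := 1) ?_ (Filter.Eventually.of_forall fun ω => ?_)
    · have : Measurable fun x : E => Complex.exp (L x * Complex.I) := by fun_prop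
      exact (this.comp_aemeasurable (hm t)).aestronglyMeasurable
    · rw [Complex.norm_exp_ofReal_mul_I]
  have heq : charFunDual (P.map (w t)) L = ∫ ω, Complex.exp (L (w t ω) * Complex.I) ∂P := by
    rw [charFunDual_apply, integral_map (hm t)]
    have : Measurable fun x : E => Complex.exp (L x * Complex.I) := by fun_prop
    exact this.aestronglyMeasurable
  have h1 : charFunDual (P.map (w t)) L - 1 =
      ∫ ω, (Complex.exp (L (w t ω) * Complex.I) - 1) ∂P := by
    rw [integral_sub hint (integrable_const _), heq]; simp
  have h2 : ‖charFunDual (P.map (w t)) L - 1‖ₑ ≤ 2 * (1 / 4) := by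
    rw [h1]
    refine (enorm_integral_le_lintegral_enorm _).trans ?_
    refine le_trans (lintegral_mono fun ω => ?_)
      ((lintegral_const_mul' 2 _ (by simp)).trans_le (mul_le_mul_right (hδ' t) 2))
    rcases le_total 1 (δ * ‖w t ω‖ₑ : ℝ≥0∞) with hc | hc
    · rw [min_eq_left hc]
      refine (enorm_sub_le).trans ?_
      have h3 : ‖Complex.exp (L (w t ω) * Complex.I)‖ₑ = 1 := by
        rw [← ofReal_norm, Complex.norm_exp_ofReal_mul_I, ENNReal.ofReal_one]
      rw [h3]
      simp [one_add_one_eq_two]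
    · rw [min_eq_right hc, mul_comm (L (w t ω) : ℂ) Complex.I]
      refine (Real.enorm_exp_I_mul_ofReal_sub_one_le).trans ?_
      have h4 : ‖L (w t ω)‖ₑ ≤ δ * ‖w t ω‖ₑ := by
        rw [enorm_eq_nnnorm, enorm_eq_nnnorm, ← ENNReal.coe_mul, ENNReal.coe_le_coe,
          ← NNReal.coe_le_coe]
        push_cast
        exact (L.le_opNorm _).trans (mul_le_mul_of_nonneg_right hL (norm_nonneg _))
      refine h4.trans ?_
      exact le_mul_of_one_le_left zero_le (by norm_num)
  have h5 : ‖charFunDual (P.map (w t)) L - 1‖ ≤ 1 / 2 := by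
    have h6 : (2 * (1 / 4) : ℝ≥0∞) = ENNReal.ofReal (1 / 2) := by
      rw [show (2 : ℝ≥0∞) = ENNReal.ofReal 2 by simp, show (1 / 4 : ℝ≥0∞) = ENNReal.ofReal (1 / 4) by
        rw [ENNReal.ofReal_div_of_pos (by norm_num)]; simp, ← ENNReal.ofReal_mul (by norm_num)]
      norm_num
    rw [h6, ← ofReal_norm] at h2
    exact (ENNReal.ofReal_le_ofReal_iff (by norm_num)).1 h2
  have h7 := norm_sub_norm_le (1 : ℂ) (charFunDual (P.map (w t)) L)
  rw [norm_sub_rev, norm_one] at h7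
  linarith

end Tight

/-! ### Autoregressions of order one driven by i.i.d. noise -/

section AR

variable {Ω : Type*} [MeasurableSpace Ω] {P : Measure Ω} {n : ℕ}

/-- Multiplication by a matrix, as a real-linear continuous map. -/
noncomputable def mulVecCLM {m n : ℕ} (A : Matrix (Fin m) (Fin n) ℂ) :
    (Fin n → ℂ) →L[ℝ] (Fin m → ℂ) :=
  LinearMap.toContinuousLinearMap ((Matrix.mulVecLin A).restrictScalars ℝ)

@[simp]
theorem mulVecCLM_apply {m n : ℕ} (A : Matrix (Fin m) (Fin n) ℂ) (x : Fin n → ℂ) :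
    mulVecCLM A x = A *ᵥ x := rfl

theorem measurable_mulVec {m n : ℕ} (A : Matrix (Fin m) (Fin n) ℂ) :
    Measurable fun x : Fin n → ℂ => A *ᵥ x :=
  (mulVecCLM A).continuous.measurable

theorem ae_eq_pow_mulVec_add {A : Matrix (Fin n) (Fin n) ℂ} {w ξ : ℤ → Ω → (Fin n → ℂ)}
    (hrec : ∀ t, ∀ᵐ ω ∂P, w t ω = A *ᵥ w (t - 1) ω + ξ t ω) (k : ℕ) (t : ℤ) :
    ∀ᵐ ω ∂P, w t ω = A ^ k *ᵥ w (t - k) ω + ∑ j ∈ Finset.range k, A ^ j *ᵥ ξ (t - j) ω := by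
  induction k with
  | zero => simp
  | succ k ih =>
    filter_upwards [ih, hrec (t - k)] with ω h1 h2
    rw [h1, h2, Matrix.mulVec_add, Matrix.mulVec_mulVec, ← pow_succ, Finset.sum_range_succ]
    have : t - (k : ℤ) - 1 = t - ((k + 1 : ℕ) : ℤ) := by push_cast; ring
    rw [this]
    abel

/-- The coefficient of `w_{t-kl}` in `(1 - (μ R)^k)^N w_t`, where `R` is the backward shift. -/
noncomputable def diffCoeff (μ : ℂ) (N k l : ℕ) : ℂ := (-μ ^ k) ^ l * (N.choose l : ℂ)

/-- By the binomial theorem the sum is (A^k - μ^k)^N. -/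
theorem sum_diffCoeff_smul_pow {A : Matrix (Fin n) (Fin n) ℂ} {μ : ℂ} {N : ℕ}
    (hA : (A - μ • 1) ^ N = 0) (k : ℕ) :
    ∑ l ∈ Finset.range (N + 1), diffCoeff μ N k l • A ^ (k * (N - l)) = 0 := by
  have hc : Commute (-μ ^ k • (1 : Matrix (Fin n) (Fin n) ℂ)) (A ^ k) :=
    (Commute.one_left _).smul_left _
  have h := hc.add_pow N
  have h0 : -μ ^ k • (1 : Matrix (Fin n) (Fin n) ℂ) + A ^ k = A ^ k - μ ^ k • 1 := by
    rw [neg_smul]; abel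
  rw [h0, pow_sub_smul_one_pow_eq_zero hA] at h
  rw [h]
  refine Finset.sum_congr rfl fun l _ => ?_
  rw [smul_pow, one_pow, ← pow_mul, smul_mul_assoc, one_mul, smul_mul_assoc, diffCoeff, mul_smul,
    ← (Nat.cast_commute (N.choose l) _).eq, ← nsmul_eq_mul, Nat.cast_smul_eq_nsmul]

theorem norm_diffCoeff_le {μ : ℂ} (hμ : ‖μ‖ ≤ 1) (N k l : ℕ) :
    ‖diffCoeff μ N k l‖ ≤ N.choose l := by
  rw [diffCoeff, norm_mul, norm_pow, norm_neg, norm_pow, Complex.norm_natCast]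
  refine mul_le_of_le_one_left (Nat.cast_nonneg _) (pow_le_one₀ (by positivity) ?_)
  exact pow_le_one₀ (norm_nonneg _) hμ

/-- The noise `ξ_s`, `s ≤ -k`, in `(1 - (μ R)^k)^(N+1) w_0`. -/
noncomputable def oldNoise (A : Matrix (Fin n) (Fin n) ℂ) (μ : ℂ) (N k : ℕ)
    (ξ : ℤ → Ω → (Fin n → ℂ)) (ω : Ω) : Fin n → ℂ :=
  ∑ j ∈ Finset.range (k * N), A ^ (k + j) *ᵥ ξ (-((k + j : ℕ) : ℤ)) ω +
    ∑ l ∈ Finset.range (N + 1), diffCoeff μ (N + 1) k (l + 1) •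
      ∑ j ∈ Finset.range (k * (N - l)), A ^ j *ᵥ ξ (-((k * (l + 1) + j : ℕ) : ℤ)) ω

/-- All w_{-kl} are unfolded down to the common time -k(N+1), where the total coefficient of w
vanishes by `sum_diffCoeff_smul_pow`. Only noise remains, and the part more recent than -k comes
from the term l = 0 alone. -/
theorem ae_sum_diffCoeff_smul_eq {A : Matrix (Fin n) (Fin n) ℂ} {μ : ℂ} {N : ℕ}
    (hA : (A - μ • 1) ^ N = 0) {w ξ : ℤ → Ω → (Fin n → ℂ)}
    (hrec : ∀ t, ∀ᵐ ω ∂P, w t ω = A *ᵥ w (t - 1) ω + ξ t ω) (k : ℕ) :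
    ∀ᵐ ω ∂P, ∑ l ∈ Finset.range (N + 1 + 1),
        diffCoeff μ (N + 1) k l • w (-((k * l : ℕ) : ℤ)) ω =
      ∑ j ∈ Finset.range k, A ^ j *ᵥ ξ (-(j : ℤ)) ω + oldNoise A μ N k ξ ω := by
  have h1 : ∀ᵐ ω ∂P, ∀ l : ℕ, w (-((k * l : ℕ) : ℤ)) ω =
      A ^ (k * (N + 1 - l)) *ᵥ w (-((k * l : ℕ) : ℤ) - (k * (N + 1 - l) : ℕ)) ω +
      ∑ j ∈ Finset.range (k * (N + 1 - l)), A ^ j *ᵥ ξ (-((k * l : ℕ) : ℤ) - j) ω :=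
    ae_all_iff.2 fun l => ae_eq_pow_mulVec_add hrec _ _
  -- The exponent N would suffice for the cancellation; N + 1 guarantees that the term l = 0 is
  -- unfolded over at least k steps, also when N = 0.
  have hA' : (A - μ • 1) ^ (N + 1) = 0 := by rw [pow_succ, hA, zero_mul]
  filter_upwards [h1] with ω hω
  have h2 : ∀ l ∈ Finset.range (N + 1 + 1), diffCoeff μ (N + 1) k l • w (-((k * l : ℕ) : ℤ)) ω =
      (diffCoeff μ (N + 1) k l • A ^ (k * (N + 1 - l))) *ᵥ w (-((k * (N + 1) : ℕ) : ℤ)) ω +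
      diffCoeff μ (N + 1) k l •
        ∑ j ∈ Finset.range (k * (N + 1 - l)), A ^ j *ᵥ ξ (-((k * l : ℕ) : ℤ) - j) ω := by
    intro l hl
    have hl' : l ≤ N + 1 := by have := Finset.mem_range.1 hl; omega
    have h3 : -((k * l : ℕ) : ℤ) - (k * (N + 1 - l) : ℕ) = -((k * (N + 1) : ℕ) : ℤ) := by
      rw [sub_eq_add_neg, ← neg_add, ← Nat.cast_add, ← Nat.mul_add, Nat.add_sub_of_le hl']
    conv_lhs => rw [hω l]
    rw [h3, smul_add, Matrix.smul_mulVec]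
  rw [Finset.sum_congr rfl h2, Finset.sum_add_distrib, ← Matrix.sum_mulVec,
    sum_diffCoeff_smul_pow hA', Matrix.zero_mulVec, zero_add, Finset.sum_range_succ', oldNoise,
    add_comm, ← add_assoc]
  congr 1
  · have h4 : k * (N + 1 - 0) = k + k * N := by rw [Nat.sub_zero]; ring
    -- The first k of these k + kN steps form the main sum, the others belong to `oldNoise`.
    rw [h4, Finset.sum_range_add]
    have h5 : diffCoeff μ (N + 1) k 0 = 1 := by simp [diffCoeff]
    rw [h5, one_smul]
    congr 1
    · refine Finset.sum_congr rfl fun j _ => ?_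
      simp
    · refine Finset.sum_congr rfl fun j _ => ?_
      simp
  · refine Finset.sum_congr rfl fun l _ => ?_
    rw [Nat.add_sub_add_right]
    congr 1
    refine Finset.sum_congr rfl fun j _ => ?_
    congr 2
    push_cast
    ring

theorem measurable_oldNoise (A : Matrix (Fin n) (Fin n) ℂ) (μ : ℂ) (N k : ℕ)
    {ξ : ℤ → Ω → (Fin n → ℂ)} (hξ : ∀ s : ℤ, s ≤ -(k : ℤ) → Measurable (ξ s)) :
    Measurable (oldNoise A μ N k ξ) := by
  unfold oldNoise
  refine Measurable.add ?_ ?_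
  · refine Finset.measurable_fun_sum _ fun j _ => (measurable_mulVec _).comp (hξ _ ?_)
    push_cast; omega
  · refine Finset.measurable_fun_sum _ fun l _ => Measurable.fun_const_smul ?_ _
    refine Finset.measurable_fun_sum _ fun j _ => (measurable_mulVec _).comp (hξ _ ?_)
    have : k ≤ k * (l + 1) + j := (Nat.le_mul_of_pos_right k (Nat.add_one_pos l)).trans (Nat.le_add_right _ _)
    omega

theorem measurable_sum_pow_mulVec (A : Matrix (Fin n) (Fin n) ℂ) (k : ℕ)
    {ξ : ℤ → Ω → (Fin n → ℂ)} (hξ : ∀ s : ℤ, -(k : ℤ) < s → Measurable (ξ s)) :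
    Measurable fun ω => ∑ j ∈ Finset.range k, A ^ j *ᵥ ξ (-(j : ℤ)) ω := by
  refine Finset.measurable_fun_sum _ fun j hj => (measurable_mulVec _).comp (hξ _ ?_)
  have := Finset.mem_range.1 hj
  omega

/-- The two sums use the noise at times > -k and at times ≤ -k respectively. -/
theorem indepFun_oldNoise [IsProbabilityMeasure P] (A : Matrix (Fin n) (Fin n) ℂ) (μ : ℂ)
    (N k : ℕ) {ξ : ℤ → Ω → (Fin n → ℂ)} (hξ : IsIID ξ P) :
    IndepFun (fun ω => ∑ j ∈ Finset.range k, A ^ j *ᵥ ξ (-(j : ℤ)) ω) (oldNoise A μ N k ξ) P := by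
  have h := indep_iSup_of_disjoint (fun i => (hξ.measurable i).comap_le) hξ.indep.iIndep
    (S := Set.Ioi (-(k : ℤ))) (T := Set.Iic (-(k : ℤ))) (by
      rw [Set.disjoint_left]; intro a h1 h2; exact absurd (Set.mem_Iic.1 h2) (not_le.2 h1))
  rw [IndepFun_iff_Indep]
  refine indep_of_indep_of_le_left (indep_of_indep_of_le_right h ?_) ?_
  · rw [← measurable_iff_comap_le]
    -- The measurability lemma is applied with the σ-algebra generated by the noise up to time -k in
    -- place of the ambient one.
    refine @measurable_oldNoise Ω (_) n A μ N k ξ fun s hs => ?_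
    rw [measurable_iff_comap_le]
    exact le_iSup₂_of_le s hs le_rfl
  · rw [← measurable_iff_comap_le]
    refine @measurable_sum_pow_mulVec Ω (_) n A k ξ fun s hs => ?_
    rw [measurable_iff_comap_le]
    exact le_iSup₂_of_le s hs le_rfl

/-- The independent summand contributes a factor of modulus at most 1. This is how `oldNoise` is
discarded. -/
theorem norm_charFunDual_map_add_le {E : Type*} [NormedAddCommGroup E] [NormedSpace ℝ E]
    [MeasurableSpace E] [BorelSpace E] [SecondCountableTopology E] [IsProbabilityMeasure P]
    {X Y : Ω → E} (hX : Measurable X) (hY : Measurable Y) (h : IndepFun X Y P)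
    (L : StrongDual ℝ E) :
    ‖charFunDual (P.map (fun ω => X ω + Y ω)) L‖ ≤ ‖charFunDual (P.map X) L‖ := by
  rw [h.charFunDual_map_fun_add_eq_mul hX.aemeasurable hY.aemeasurable, Pi.mul_apply, norm_mul]
  have := Measure.isProbabilityMeasure_map (μ := P) hY.aemeasurable
  refine mul_le_of_le_one_right (norm_nonneg _) ?_
  have := Measure.isProbabilityMeasure_map (μ := P.map Y) (f := L) (by fun_prop)
  have h1 := norm_charFun_le_one (μ := (P.map Y).map L) 1
  rwa [← charFunDual_eq_charFun_map_one] at h1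

theorem charFunDual_map_sum_pow_mulVec [IsProbabilityMeasure P] (A : Matrix (Fin n) (Fin n) ℂ)
    {ξ : ℤ → Ω → (Fin n → ℂ)} (hξ : IsIID ξ P) (k : ℕ) (L : StrongDual ℝ (Fin n → ℂ)) :
    charFunDual (P.map fun ω => ∑ j ∈ Finset.range k, A ^ j *ᵥ ξ (-(j : ℤ)) ω) L =
      ∏ j ∈ Finset.range k, charFunDual (P.map (ξ 0)) (L.comp (mulVecCLM (A ^ j))) := by
  have hm (j : ℕ) : Measurable fun ω => A ^ j *ᵥ ξ (-(j : ℤ)) ω :=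
    (measurable_mulVec _).comp (hξ.measurable _)
  have hind : iIndepFun (fun (j : ℕ) ω => A ^ j *ᵥ ξ (-(j : ℤ)) ω) P := by
    have h1 : iIndepFun (fun j : ℕ => ξ (-(j : ℤ))) P :=
      hξ.indep.precomp (g := fun j : ℕ => -(j : ℤ)) fun a b hab => by simpa using hab
    exact h1.comp (fun j x => A ^ j *ᵥ x) fun j => measurable_mulVec _
  rw [(hind.restrict (Finset.range k)).charFunDual_map_fun_finsetSum_eq_prod
    fun j _ => (hm j).aemeasurable, Finset.prod_apply]
  refine Finset.prod_congr rfl fun j _ => ?_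
  rw [← charFunDual_map, ← (hξ.identDistrib (-(j : ℤ)) 0).map_eq,
    Measure.map_map (mulVecCLM (A ^ j)).continuous.measurable (hξ.measurable _)]
  rfl

/-- The iterated differences of w are tight uniformly in k because, for |μ| ≤ 1, their coefficients
are bounded by binomial coefficients. Their characteristic functions thus stay away from 0 near the
origin, and dropping the independent old noise leaves the product. -/
theorem exists_half_le_prod_norm_charFunDual [IsProbabilityMeasure P]
    {A : Matrix (Fin n) (Fin n) ℂ} {μ : ℂ} {N : ℕ} (hA : (A - μ • 1) ^ N = 0) (hμ : ‖μ‖ ≤ 1)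
    {w ξ : ℤ → Ω → (Fin n → ℂ)} (hw : ∀ t, Measurable (w t)) (hT : UniformlyTight w P)
    (hξ : IsIID ξ P) (hrec : ∀ t, ∀ᵐ ω ∂P, w t ω = A *ᵥ w (t - 1) ω + ξ t ω) :
    ∃ δ : ℝ, 0 < δ ∧ ∀ L : StrongDual ℝ (Fin n → ℂ), ‖L‖ ≤ δ → ∀ k : ℕ,
      1 / 2 ≤ ∏ j ∈ Finset.range k,
        ‖charFunDual (P.map (ξ 0)) (L.comp (mulVecCLM (A ^ j)))‖ := by
  have hTT : UniformlyTight (fun (k : ℕ) ω => ∑ l ∈ Finset.range (N + 1 + 1),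
      diffCoeff μ (N + 1) k l • w (-((k * l : ℕ) : ℤ)) ω) P := by
    refine UniformlyTight.sum _ (fun l _ => hT.of_norm_le (fun k => -((k * l : ℕ) : ℤ))
      (C := (N + 1).choose l) fun k => Filter.Eventually.of_forall fun ω => ?_)
      fun l _ k => ((hw _).fun_const_smul _).aemeasurable
    rw [norm_smul]
    exact mul_le_mul_of_nonneg_right (norm_diffCoeff_le hμ _ _ _) (norm_nonneg _)
  obtain ⟨δ, hδ, h⟩ := hTT.half_le_norm_charFunDual
    fun k => (Finset.measurable_fun_sum _ fun l _ => (hw _).fun_const_smul _).aemeasurable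
  refine ⟨δ, hδ, fun L hL k => (h L hL k).trans ?_⟩
  rw [Measure.map_congr (ae_sum_diffCoeff_smul_eq hA hrec k), ← norm_prod,
    ← charFunDual_map_sum_pow_mulVec A hξ]
  exact norm_charFunDual_map_add_le (measurable_sum_pow_mulVec A k fun s _ => hξ.measurable s)
    (measurable_oldNoise A μ N k fun s _ => hξ.measurable s) (indepFun_oldNoise A μ N k hξ) L

/-- The law of the difference of two independent random vectors with law `ρ`. -/
noncomputable def symmetrization {E : Type*} [MeasurableSpace E] [Sub E] (ρ : Measure E) :
    Measure E :=
  (ρ.prod ρ).map fun x => x.1 - x.2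

section Symmetrization

variable {E : Type*} [NormedAddCommGroup E] [NormedSpace ℝ E] [MeasurableSpace E] [BorelSpace E]
  [SecondCountableTopology E] (ρ : Measure E) [IsProbabilityMeasure ρ]

instance : IsProbabilityMeasure (symmetrization ρ) :=
  Measure.isProbabilityMeasure_map (by fun_prop)

theorem charFunDual_symmetrization (L : StrongDual ℝ E) :
    charFunDual (symmetrization ρ) L = ((‖charFunDual ρ L‖ ^ 2 : ℝ) : ℂ) := by
  have h1 : charFunDual (symmetrization ρ) L =
      ∫ x : E × E, Complex.exp (L x.1 * Complex.I) * Complex.exp (-(L x.2 * Complex.I))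
        ∂(ρ.prod ρ) := by
    rw [charFunDual_apply, symmetrization, integral_map (by fun_prop) (by fun_prop)]
    refine integral_congr_ae (Filter.Eventually.of_forall fun x => ?_)
    simp only [map_sub, Complex.ofReal_sub]
    rw [← Complex.exp_add]
    ring_nf
  have h2 : ∫ x : E, Complex.exp (-(L x * Complex.I)) ∂ρ =
      (starRingEnd ℂ) (charFunDual ρ L) := by
    rw [charFunDual_apply, ← integral_conj]
    refine integral_congr_ae (Filter.Eventually.of_forall fun x => ?_)
    simp only [← Complex.exp_conj, map_mul, Complex.conj_ofReal, Complex.conj_I, mul_neg]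
  rw [h1, integral_prod_mul (fun x => Complex.exp (L x * Complex.I))
    fun x => Complex.exp (-(L x * Complex.I)), h2, ← charFunDual_apply, Complex.mul_conj,
    Complex.normSq_eq_norm_sq]

end Symmetrization

/-- Since x² ≤ exp(-(1 - x²)), the squared product, which is at least 1/4, is at most exp(-∑(1 -
x²)); and e^{-2} ≤ 1/4. -/
theorem sum_one_sub_sq_le_two {k : ℕ} {x : ℕ → ℝ}
    (h : 1 / 2 ≤ ∏ j ∈ Finset.range k, x j) :
    ∑ j ∈ Finset.range k, (1 - x j ^ 2) ≤ 2 := by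
  have h1 : ∏ j ∈ Finset.range k, x j ^ 2 ≤
      Real.exp (-∑ j ∈ Finset.range k, (1 - x j ^ 2)) := by
    rw [← Finset.sum_neg_distrib, Real.exp_sum]
    refine Finset.prod_le_prod (fun j _ => sq_nonneg _) fun j _ => ?_
    have := Real.add_one_le_exp (-(1 - x j ^ 2))
    linarith
  rw [Finset.prod_pow] at h1
  have h2 : (1 / 4 : ℝ) ≤ (∏ j ∈ Finset.range k, x j) ^ 2 := by nlinarith
  by_contra! hcon
  have h3 : Real.exp (-∑ j ∈ Finset.range k, (1 - x j ^ 2)) < Real.exp (-2) :=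
    Real.exp_lt_exp.2 (by linarith)
  have h4 : Real.exp (-2) ≤ 1 / 4 := by
    have h5 : Real.exp (-2) = (Real.exp 1 ^ 2)⁻¹ := by
      rw [← Real.exp_nat_mul, ← Real.exp_neg]; norm_num
    have h6 : (2 : ℝ) ≤ Real.exp 1 := by have := Real.add_one_le_exp (1 : ℝ); linarith
    rw [h5, one_div]
    exact inv_anti₀ (by norm_num) (by nlinarith)
  linarith

theorem exists_sum_one_sub_charFunDual_le [IsProbabilityMeasure P]
    {A : Matrix (Fin n) (Fin n) ℂ} {μ : ℂ} {N : ℕ} (hA : (A - μ • 1) ^ N = 0) (hμ : ‖μ‖ ≤ 1)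
    {w ξ : ℤ → Ω → (Fin n → ℂ)} (hw : ∀ t, Measurable (w t)) (hT : UniformlyTight w P)
    (hξ : IsIID ξ P) (hrec : ∀ t, ∀ᵐ ω ∂P, w t ω = A *ᵥ w (t - 1) ω + ξ t ω) :
    ∃ δ : ℝ, 0 < δ ∧ ∀ L : StrongDual ℝ (Fin n → ℂ), ‖L‖ ≤ δ → ∀ k : ℕ,
      ∑ j ∈ Finset.range k, (1 - ‖charFunDual (P.map (ξ 0)) (L.comp (mulVecCLM (A ^ j)))‖ ^ 2)
        ≤ 2 := by
  obtain ⟨δ, hδ, h⟩ := exists_half_le_prod_norm_charFunDual hA hμ hw hT hξ hrec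
  exact ⟨δ, hδ, fun L hL k => sum_one_sub_sq_le_two (h L hL k)⟩

end AR

/-! ### Logarithmic moments -/

section LogMoment

open scoped ENNReal

variable {E : Type*} [NormedAddCommGroup E] [MeasurableSpace E] [OpensMeasurableSpace E]

theorem measurable_ofReal_posLog_norm :
    Measurable fun x : E => ENNReal.ofReal (Real.posLog ‖x‖) :=
  ENNReal.measurable_ofReal.comp (Real.continuous_posLog.measurable.comp measurable_norm)

theorem natCast_le_tsum_indicator {s : ℕ → Prop} [DecidablePred s] {J : ℕ} (h : ∀ j < J, s j) :
    (J : ℝ≥0∞) ≤ ∑' j, if s j then 1 else 0 := by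
  refine le_trans ?_ (ENNReal.sum_le_tsum (Finset.range J))
  rw [Finset.sum_congr rfl fun j hj => if_pos (h j (Finset.mem_range.1 hj))]
  simp

theorem tsum_measure_lt_eq {ν : Measure E} (g : ℕ → ℝ) :
    ∑' j, ν {x | g j < ‖x‖} = ∫⁻ x, ∑' j, (if g j < ‖x‖ then 1 else 0) ∂ν := by
  have hs (j : ℕ) : MeasurableSet {x : E | g j < ‖x‖} := measurableSet_lt measurable_const
    measurable_norm
  rw [lintegral_tsum fun j => (Measurable.ite (hs j) measurable_const measurable_const).aemeasurable]
  refine tsum_congr fun j => ?_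
  rw [← lintegral_indicator_one (hs j)]
  rfl

/-- The sum of tail probabilities is the mean number of j with R σ^j < ‖x‖, and this number
dominates (log⁺ ‖x‖ - log⁺ R) / log σ. -/
theorem lintegral_posLog_lt_top_of_tsum {ν : Measure E} [IsFiniteMeasure ν] {R σ : ℝ}
    (hσ : 1 < σ) (h : ∑' j : ℕ, ν {x | R * σ ^ j < ‖x‖} ≠ ⊤) :
    ∫⁻ x, ENNReal.ofReal (Real.posLog ‖x‖) ∂ν < ⊤ := by
  have hpt (x : E) : ENNReal.ofReal (Real.posLog ‖x‖) ≤ ENNReal.ofReal (Real.posLog R) +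
      ENNReal.ofReal (Real.log σ) * ∑' j : ℕ, if R * σ ^ j < ‖x‖ then 1 else 0 := by
    by_cases hex : ∃ j : ℕ, ‖x‖ ≤ R * σ ^ j
    · classical
      set J := Nat.find hex with hJ
      have h1 : ‖x‖ ≤ R * σ ^ J := Nat.find_spec hex
      have h2 : ∀ j < J, R * σ ^ j < ‖x‖ := fun j hj => not_le.1 (Nat.find_min hex hj)
      have h3 : Real.posLog ‖x‖ ≤ Real.posLog R + Real.log σ * J := by
        refine (Real.posLog_le_posLog (norm_nonneg x) h1).trans (Real.posLog_mul.trans ?_)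
        rw [Real.posLog_pow, Real.posLog_eq_log (x := σ)
          (by rw [abs_of_pos (by linarith)]; exact hσ.le), mul_comm]
      refine (ENNReal.ofReal_le_ofReal h3).trans ?_
      rw [ENNReal.ofReal_add Real.posLog_nonneg (mul_nonneg (Real.log_nonneg hσ.le)
        (Nat.cast_nonneg _)), ENNReal.ofReal_mul (Real.log_nonneg hσ.le), ENNReal.ofReal_natCast]
      exact add_le_add le_rfl (mul_le_mul_right (natCast_le_tsum_indicator h2) _)
    -- This happens only for R ≤ 0; the count is then infinite and the bound trivial.
    · push Not at hex
      have h1 : ∑' j : ℕ, (if R * σ ^ j < ‖x‖ then 1 else 0 : ℝ≥0∞) = ⊤ := by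
        rw [tsum_congr fun j => if_pos (hex j)]
        exact ENNReal.tsum_const_eq_top_of_ne_zero one_ne_zero
      rw [h1, ENNReal.mul_top]
      · simp
      · simpa using Real.log_pos hσ
  refine (lintegral_mono hpt).trans_lt ?_
  rw [lintegral_add_left measurable_const, lintegral_const, lintegral_const_mul' _ _ (by simp),
    ← tsum_measure_lt_eq]
  exact ENNReal.add_lt_top.2 ⟨ENNReal.mul_lt_top (by simp) (measure_lt_top _ _),
    ENNReal.mul_lt_top (by simp) h.lt_top⟩

/-- Conversely, the number of j with σ^j < ‖x‖ is at most 1 + log⁺ ‖x‖ / log σ. -/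
theorem tsum_measure_pow_lt_ne_top {ν : Measure E} {σ : ℝ} [IsFiniteMeasure ν]
    (hσ : 1 < σ) (h : ∫⁻ x, ENNReal.ofReal (Real.posLog ‖x‖) ∂ν < ⊤) :
    ∑' j : ℕ, ν {x | σ ^ j < ‖x‖} ≠ ⊤ := by
  have hlog := Real.log_pos hσ
  have hpt (x : E) : ENNReal.ofReal (Real.log σ) * ∑' j : ℕ, (if σ ^ j < ‖x‖ then 1 else 0) ≤
      ENNReal.ofReal (Real.log σ) + ENNReal.ofReal (Real.posLog ‖x‖) := by
    obtain ⟨J, hJ⟩ := pow_unbounded_of_one_lt ‖x‖ hσ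
    classical
    have hex : ∃ j : ℕ, ‖x‖ ≤ σ ^ j := ⟨J, hJ.le⟩
    set K := Nat.find hex with hK
    have h1 : ‖x‖ ≤ σ ^ K := Nat.find_spec hex
    have h2 : ∑' j : ℕ, (if σ ^ j < ‖x‖ then 1 else 0 : ℝ≥0∞) ≤ K := by
      rw [tsum_eq_sum (s := Finset.range K)]
      · refine (Finset.sum_le_sum fun j _ => (?_ : _ ≤ (1 : ℝ≥0∞))).trans (by simp)
        split_ifs <;> simp
      · intro j hj
        rw [if_neg]
        rw [Finset.mem_range, not_lt] at hj
        exact not_lt.2 (h1.trans (pow_le_pow_right₀ hσ.le hj))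
    refine (mul_le_mul_right h2 _).trans ?_
    rw [← ENNReal.ofReal_natCast, ← ENNReal.ofReal_mul hlog.le,
      ← ENNReal.ofReal_add hlog.le Real.posLog_nonneg]
    refine ENNReal.ofReal_le_ofReal ?_
    rcases Nat.eq_zero_or_pos K with h0 | h0
    · rw [h0]; simp only [Nat.cast_zero, mul_zero]
      exact add_nonneg hlog.le Real.posLog_nonneg
    · have h3 : σ ^ (K - 1) < ‖x‖ := not_le.1 (Nat.find_min hex (Nat.sub_lt h0 one_pos))
      have h4 : Real.posLog (σ ^ (K - 1)) ≤ Real.posLog ‖x‖ :=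
        Real.posLog_le_posLog (by positivity) h3.le
      rw [Real.posLog_pow, Real.posLog_eq_log (x := σ)
        (by rw [abs_of_pos (by linarith)]; exact hσ.le), Nat.cast_sub h0] at h4
      push_cast at h4
      linarith
  have hfin : ENNReal.ofReal (Real.log σ) * ∑' j : ℕ, ν {x | σ ^ j < ‖x‖} < ⊤ := by
    rw [tsum_measure_lt_eq, ← lintegral_const_mul' _ _ (by simp)]
    refine (lintegral_mono hpt).trans_lt ?_
    rw [lintegral_add_left measurable_const, lintegral_const]
    exact ENNReal.add_lt_top.2 ⟨ENNReal.mul_lt_top (by simp) (measure_lt_top _ _), h⟩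
  intro htop
  rw [htop, ENNReal.mul_top (by simpa using hlog)] at hfin
  exact lt_irrefl _ hfin

theorem lintegral_posLog_lt_top_of_le {Ω : Type*} [MeasurableSpace Ω] {P : Measure Ω}
    [IsFiniteMeasure P] {f g : Ω → ℝ} {C : ℝ} (hf : ∀ ω, 0 ≤ f ω)
    (hfg : ∀ ω, f ω ≤ C * g ω) (hg : ∫⁻ ω, ENNReal.ofReal (Real.posLog (g ω)) ∂P < ⊤) :
    ∫⁻ ω, ENNReal.ofReal (Real.posLog (f ω)) ∂P < ⊤ := by
  refine (lintegral_mono (g := fun ω => ENNReal.ofReal (Real.posLog C) +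
    ENNReal.ofReal (Real.posLog (g ω))) fun ω => ?_).trans_lt ?_
  · simp only
    rw [← ENNReal.ofReal_add Real.posLog_nonneg Real.posLog_nonneg]
    exact ENNReal.ofReal_le_ofReal ((Real.posLog_le_posLog (hf ω) (hfg ω)).trans Real.posLog_mul)
  · rw [lintegral_add_left measurable_const, lintegral_const]
    exact ENNReal.add_lt_top.2 ⟨ENNReal.mul_lt_top (by simp) (measure_lt_top _ _), hg⟩

/-- By Fubini some fixed y has E log⁺ ‖X - y‖ < ∞, and log⁺ is subadditive up to log 2. -/
theorem lintegral_posLog_lt_top_of_symmetrization [BorelSpace E] [SecondCountableTopology E]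
    {ρ : Measure E} [IsProbabilityMeasure ρ]
    (h : ∫⁻ x, ENNReal.ofReal (Real.posLog ‖x‖) ∂(symmetrization ρ) < ⊤) :
    ∫⁻ x, ENNReal.ofReal (Real.posLog ‖x‖) ∂ρ < ⊤ := by
  have hm : Measurable fun x : E × E => x.1 - x.2 := measurable_fst.sub measurable_snd
  rw [symmetrization, lintegral_map measurable_ofReal_posLog_norm hm,
    lintegral_prod_symm (fun x : E × E => ENNReal.ofReal (Real.posLog ‖x.1 - x.2‖))
      (measurable_ofReal_posLog_norm.comp hm).aemeasurable] at h
  have h1 : ∀ᵐ y ∂ρ, ∫⁻ x, ENNReal.ofReal (Real.posLog ‖x - y‖) ∂ρ < ⊤ :=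
    ae_lt_top (measurable_ofReal_posLog_norm.comp hm).lintegral_prod_left' h.ne
  obtain ⟨y, hy⟩ := h1.exists
  refine (lintegral_mono (g := fun x => ENNReal.ofReal (Real.log 2 + Real.posLog ‖y‖) +
    ENNReal.ofReal (Real.posLog ‖x - y‖)) fun x => ?_).trans_lt ?_
  · simp only
    rw [← ENNReal.ofReal_add (add_nonneg (Real.log_nonneg (by norm_num)) Real.posLog_nonneg)
      Real.posLog_nonneg]
    refine ENNReal.ofReal_le_ofReal ?_
    have h2 := Real.posLog_norm_add_le (x - y) y
    rw [sub_add_cancel] at h2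
    linarith
  · rw [lintegral_add_left measurable_const, lintegral_const]
    exact ENNReal.add_lt_top.2 ⟨ENNReal.mul_lt_top (by simp) (measure_lt_top _ _), hy⟩

end LogMoment

/-! ### Necessity of the logarithmic moment off the unit circle -/

section Necessity

open scoped ENNReal

variable {Ω : Type*} [MeasurableSpace Ω] {P : Measure Ω} {n : ℕ}

/-- The truncation inequality bounds P(|L(A^j x)| > r) by (r/2) ∫_{-2/r}^{2/r} |1 - φ|. Summing over
j before integrating allows the hypothesis to be used pointwise. -/
theorem sum_symmetrization_real_abs_gt_le {A : Matrix (Fin n) (Fin n) ℂ}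
    {ρ : Measure (Fin n → ℂ)} [IsProbabilityMeasure ρ] {δ : ℝ} (hδ : 0 < δ)
    (h : ∀ L : StrongDual ℝ (Fin n → ℂ), ‖L‖ ≤ δ → ∀ k : ℕ,
      ∑ j ∈ Finset.range k, (1 - ‖charFunDual ρ (L.comp (mulVecCLM (A ^ j)))‖ ^ 2) ≤ 2)
    {L : StrongDual ℝ (Fin n → ℂ)} (hL : ‖L‖ ≤ 1) (k : ℕ) :
    ∑ j ∈ Finset.range k, (symmetrization ρ).real {x | 2 / δ < |L (A ^ j *ᵥ x)|} ≤ 4 := by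
  -- This r makes the interval of integration [-δ, δ], and the bound is (r/2) · 2δ · 2 = 4.
  set r := 2 / δ with hr
  have hr0 : 0 < r := by positivity
  have hrδ : 2 * r⁻¹ = δ := by rw [hr]; field_simp
  have hcont (j : ℕ) : Continuous fun t : ℝ =>
      1 - ‖charFunDual ρ ((t • L).comp (mulVecCLM (A ^ j)))‖ ^ 2 := by
    refine continuous_const.sub ?_
    have : (fun t : ℝ => ‖charFunDual ρ ((t • L).comp (mulVecCLM (A ^ j)))‖ ^ 2) =
        fun t : ℝ => ‖charFun (ρ.map (L.comp (mulVecCLM (A ^ j)))) t‖ ^ 2 := by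
      ext t
      rw [charFun_map_eq_charFunDual_smul]
      rfl
    rw [this]
    have := Measure.isProbabilityMeasure_map (μ := ρ) (f := L.comp (mulVecCLM (A ^ j)))
      (by fun_prop)
    exact (continuous_charFun.norm).pow 2
  have h1 (j : ℕ) : (symmetrization ρ).real {x | r < |L (A ^ j *ᵥ x)|} ≤
      2⁻¹ * r * ∫ t in -δ..δ, (1 - ‖charFunDual ρ ((t • L).comp (mulVecCLM (A ^ j)))‖ ^ 2) := by
    have h2 := measureReal_abs_dual_gt_le_integral_charFunDual (μ := symmetrization ρ)
      (L.comp (mulVecCLM (A ^ j))) hr0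
    refine h2.trans (mul_le_mul_of_nonneg_left ?_ (by positivity))
    rw [neg_mul, hrδ]
    refine (intervalIntegral.norm_integral_le_integral_norm (by linarith)).trans_eq ?_
    refine intervalIntegral.integral_congr fun t _ => ?_
    rw [charFunDual_symmetrization, ← Complex.ofReal_one, ← Complex.ofReal_sub, Complex.norm_real,
      Real.norm_eq_abs, abs_of_nonneg]
    · rfl
    · have h3 : ‖charFunDual ρ (t • L.comp (mulVecCLM (A ^ j)))‖ ≤ 1 := by
        have := Measure.isProbabilityMeasure_map (μ := ρ) (f := L.comp (mulVecCLM (A ^ j)))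
          (by fun_prop)
        rw [← charFun_map_eq_charFunDual_smul]
        exact norm_charFun_le_one _
      have := pow_le_one₀ (n := 2) (norm_nonneg _) h3
      linarith
  refine (Finset.sum_le_sum fun j _ => h1 j).trans ?_
  rw [← Finset.mul_sum, ← intervalIntegral.integral_finsetSum
    fun j _ => (hcont j).intervalIntegrable _ _]
  have h4 : ∫ t in -δ..δ, ∑ j ∈ Finset.range k,
      (1 - ‖charFunDual ρ ((t • L).comp (mulVecCLM (A ^ j)))‖ ^ 2) ≤ ∫ _ in -δ..δ, (2 : ℝ) := by
    refine intervalIntegral.integral_mono_on (by linarith)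
      ((continuous_finsetSum _ fun j _ => hcont j).intervalIntegrable _ _)
      (by simp) fun t ht => h _ ?_ k
    rw [norm_smul]
    have : |t| ≤ δ := abs_le.2 ⟨ht.1, ht.2⟩
    calc ‖t‖ * ‖L‖ ≤ δ * 1 := mul_le_mul this hL (norm_nonneg _) hδ.le
      _ = δ := mul_one δ
  calc 2⁻¹ * r * _ ≤ 2⁻¹ * r * ∫ _ in -δ..δ, (2 : ℝ) :=
        mul_le_mul_of_nonneg_left h4 (by positivity)
    _ = 4 := by
        rw [intervalIntegral.integral_const, smul_eq_mul, hr]; field_simp; ring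

/-- The real part of the `i`-th coordinate, multiplied by `z`. -/
noncomputable def coordRe (i : Fin n) (z : ℂ) : StrongDual ℝ (Fin n → ℂ) :=
  Complex.reCLM.comp ((ContinuousLinearMap.mul ℝ ℂ z).comp
    (ContinuousLinearMap.proj (R := ℝ) (φ := fun _ : Fin n => ℂ) i))

@[simp]
theorem coordRe_apply (i : Fin n) (z : ℂ) (x : Fin n → ℂ) : coordRe i z x = (z * x i).re := rfl

theorem norm_coordRe_le (i : Fin n) (z : ℂ) : ‖coordRe i z‖ ≤ ‖z‖ := by
  refine ContinuousLinearMap.opNorm_le_bound _ (norm_nonneg _) fun x => ?_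
  rw [coordRe_apply, Real.norm_eq_abs]
  refine (Complex.abs_re_le_norm _).trans ?_
  rw [norm_mul]
  exact mul_le_mul_of_nonneg_left (norm_le_pi_norm x i) (norm_nonneg _)

/-- The factors 1 and -i pick out the real and imaginary parts, and |z| ≤ |Re z| + |Im z| accounts
for the 2. -/
theorem norm_gt_subset_iUnion {r : ℝ} (hr : 0 ≤ r) (x : Fin n → ℂ) (hx : 2 * r < ‖x‖) :
    ∃ i, r < |coordRe i 1 x| ∨ r < |coordRe i (-Complex.I) x| := by
  by_contra! hcon
  refine absurd hx (not_lt.2 ((pi_norm_le_iff_of_nonneg (by linarith)).2 fun i => ?_))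
  obtain ⟨h1, h2⟩ := hcon i
  simp only [coordRe_apply, one_mul, neg_mul, Complex.neg_re, Complex.mul_re, Complex.I_re,
    zero_mul, Complex.I_im, zero_sub, neg_neg] at h1 h2
  exact (Complex.norm_le_abs_re_add_abs_im _).trans (by linarith)

theorem tsum_symmetrization_norm_gt_ne_top {A : Matrix (Fin n) (Fin n) ℂ}
    {ρ : Measure (Fin n → ℂ)} [IsProbabilityMeasure ρ] {δ : ℝ} (hδ : 0 < δ)
    (h : ∀ L : StrongDual ℝ (Fin n → ℂ), ‖L‖ ≤ δ → ∀ k : ℕ,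
      ∑ j ∈ Finset.range k, (1 - ‖charFunDual ρ (L.comp (mulVecCLM (A ^ j)))‖ ^ 2) ≤ 2) :
    ∑' j : ℕ, symmetrization ρ {x | 2 * (2 / δ) < ‖A ^ j *ᵥ x‖} ≠ ⊤ := by
  have hsum {L : StrongDual ℝ (Fin n → ℂ)} (hL : ‖L‖ ≤ 1) :
      ∑' j : ℕ, symmetrization ρ {x | 2 / δ < |L (A ^ j *ᵥ x)|} ≤ 4 := by
    refine ENNReal.tsum_le_of_sum_range_le fun k => ?_
    have h1 := ENNReal.ofReal_le_ofReal (sum_symmetrization_real_abs_gt_le hδ h hL k)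
    rw [ENNReal.ofReal_sum_of_nonneg fun _ _ => measureReal_nonneg] at h1
    simpa [Measure.real] using h1
  have hle (j : ℕ) : symmetrization ρ {x | 2 * (2 / δ) < ‖A ^ j *ᵥ x‖} ≤
      ∑ i : Fin n, (symmetrization ρ {x | 2 / δ < |coordRe i 1 (A ^ j *ᵥ x)|} +
        symmetrization ρ {x | 2 / δ < |coordRe i (-Complex.I) (A ^ j *ᵥ x)|}) := by
    refine (measure_mono (t := ⋃ i, ({x | 2 / δ < |coordRe i 1 (A ^ j *ᵥ x)|} ∪
      {x | 2 / δ < |coordRe i (-Complex.I) (A ^ j *ᵥ x)|})) fun x hx => ?_).trans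
      ((measure_iUnion_fintype_le _ _).trans (Finset.sum_le_sum fun i _ => measure_union_le _ _))
    obtain ⟨i, hi⟩ := norm_gt_subset_iUnion (by positivity) _ hx
    exact Set.mem_iUnion.2 ⟨i, hi⟩
  have htot : ∑' j : ℕ, symmetrization ρ {x | 2 * (2 / δ) < ‖A ^ j *ᵥ x‖} ≤
      ∑ _i : Fin n, (4 + 4 : ℝ≥0∞) := by
    refine (ENNReal.tsum_le_tsum hle).trans ?_
    rw [Summable.tsum_finsetSum fun _ _ => ENNReal.summable]
    refine Finset.sum_le_sum fun i _ => ?_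
    rw [ENNReal.tsum_add]
    exact add_le_add (hsum ((norm_coordRe_le i 1).trans (by simp)))
      (hsum ((norm_coordRe_le i (-Complex.I)).trans (by simp)))
  refine (htot.trans_lt ?_).ne
  exact ENNReal.sum_lt_top.2 fun _ _ => by finiteness

/-- As A^{-j} is bounded by K σ^j, a vector with ‖x‖ > K c σ^j satisfies ‖A^j x‖ > c. The summable
tails of A^j applied to the symmetrized noise thus become geometric tails of that noise. -/
theorem lintegral_posLog_lt_top_of_recursion [IsProbabilityMeasure P]
    {A : Matrix (Fin n) (Fin n) ℂ} {μ : ℂ} {N : ℕ} (hA : (A - μ • 1) ^ N = 0) (hμ : ‖μ‖ < 1)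
    (hμ0 : μ ≠ 0) (hu : IsUnit A)
    {w ξ : ℤ → Ω → (Fin n → ℂ)} (hw : ∀ t, Measurable (w t)) (hT : UniformlyTight w P)
    (hξ : IsIID ξ P) (hrec : ∀ t, ∀ᵐ ω ∂P, w t ω = A *ᵥ w (t - 1) ω + ξ t ω) :
    ∫⁻ ω, ENNReal.ofReal (Real.posLog ‖ξ 0 ω‖) ∂P < ⊤ := by
  obtain ⟨δ, hδ, h⟩ := exists_sum_one_sub_charFunDual_le hA hμ.le hw hT hξ hrec
  have := Measure.isProbabilityMeasure_map (μ := P) (hξ.measurable 0).aemeasurable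
  have hfin := tsum_symmetrization_norm_gt_ne_top hδ h
  set σ : ℝ := ‖μ⁻¹‖ + 1 with hσ
  have hσ1 : 1 < σ := by
    have : 0 < ‖μ⁻¹‖ := norm_pos_iff.2 (inv_ne_zero hμ0)
    linarith
  obtain ⟨K, hK, hKle⟩ := exists_norm_pow_mulVec_le (inv_sub_smul_one_pow_eq_zero hA hu hμ0)
    (lt_add_one ‖μ⁻¹‖)
  have hdet := (Matrix.isUnit_iff_isUnit_det A).1 hu
  rw [← lintegral_map (f := fun x => ENNReal.ofReal (Real.posLog ‖x‖))
    measurable_ofReal_posLog_norm (hξ.measurable 0)]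
  refine lintegral_posLog_lt_top_of_symmetrization
    (lintegral_posLog_lt_top_of_tsum (R := K * (2 * (2 / δ))) hσ1 ?_)
  refine ne_top_of_le_ne_top hfin (ENNReal.tsum_le_tsum fun j => measure_mono fun x hx => ?_)
  have h1 := hKle j (A ^ j *ᵥ x)
  rw [Matrix.mulVec_mulVec, Matrix.inv_pow', Matrix.nonsing_inv_mul _ (by
    rw [Matrix.det_pow]; exact hdet.pow j), Matrix.one_mulVec, ← hσ] at h1
  have h2 : K * (2 * (2 / δ)) * σ ^ j < K * σ ^ j * ‖A ^ j *ᵥ x‖ := lt_of_lt_of_le hx h1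
  have h3 : 0 < K * σ ^ j := by positivity
  have h4 : K * (2 * (2 / δ)) * σ ^ j = K * σ ^ j * (2 * (2 / δ)) := by ring
  rw [h4] at h2
  exact lt_of_mul_lt_mul_left h2 h3.le

/-- The time-reversed process w_{-t} satisfies the recursion with the matrix A⁻¹ and the noise -A⁻¹
ξ_{1-t}, so the contracting case applies. -/
theorem lintegral_posLog_lt_top_of_recursion_expanding [IsProbabilityMeasure P]
    {A : Matrix (Fin n) (Fin n) ℂ} {μ : ℂ} {N : ℕ} (hA : (A - μ • 1) ^ N = 0) (hμ : 1 < ‖μ‖)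
    (hu : IsUnit A)
    {w ξ : ℤ → Ω → (Fin n → ℂ)} (hw : ∀ t, Measurable (w t)) (hT : UniformlyTight w P)
    (hξ : IsIID ξ P) (hrec : ∀ t, ∀ᵐ ω ∂P, w t ω = A *ᵥ w (t - 1) ω + ξ t ω) :
    ∫⁻ ω, ENNReal.ofReal (Real.posLog ‖ξ 0 ω‖) ∂P < ⊤ := by
  have hμ0 : μ ≠ 0 := norm_pos_iff.1 (by linarith)
  have hdet := (Matrix.isUnit_iff_isUnit_det A).1 hu
  have hinv : IsUnit A⁻¹ := by rwa [Matrix.isUnit_nonsing_inv_iff]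
  have hm : Measurable fun x : Fin n → ℂ => -(A⁻¹ *ᵥ x) := (measurable_mulVec _).neg
  have hξ' : IsIID (fun t ω => -(A⁻¹ *ᵥ ξ (1 - t) ω)) P := by
    refine ⟨fun t => hm.comp (hξ.measurable _), ?_, fun s t => (hξ.identDistrib _ _).comp hm⟩
    have h1 : iIndepFun (fun t : ℤ => ξ (1 - t)) P :=
      hξ.indep.precomp (g := fun t : ℤ => 1 - t) fun a b hab => by simpa using hab
    exact h1.comp (fun _ x => -(A⁻¹ *ᵥ x)) fun _ => hm
  have h2 := lintegral_posLog_lt_top_of_recursion (inv_sub_smul_one_pow_eq_zero hA hu hμ0)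
    (by rw [norm_inv]; exact inv_lt_one_of_one_lt₀ hμ) (inv_ne_zero hμ0) hinv
    (fun t => hw (-t)) (hT.comp fun t : ℤ => -t) hξ' fun t => by
      filter_upwards [hrec (1 - t)] with ω hω
      have h3 : (1 : ℤ) - t - 1 = -t := by ring
      have h4 : -(t - 1) = 1 - t := by ring
      rw [h4, hω, h3, Matrix.mulVec_add, Matrix.mulVec_mulVec, Matrix.nonsing_inv_mul _ hdet,
        Matrix.one_mulVec]
      abel
  -- Multiplication by A undoes the factor A⁻¹ in the reversed noise.
  obtain ⟨C, -, hC⟩ := exists_norm_mulVec_le A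
  have h5 : ∫⁻ ω, ENNReal.ofReal (Real.posLog ‖ξ (1 - 0) ω‖) ∂P < ⊤ := by
    refine lintegral_posLog_lt_top_of_le (C := C) (fun ω => norm_nonneg _) (fun ω => ?_) h2
    have h6 := hC (A⁻¹ *ᵥ ξ (1 - 0) ω)
    rwa [Matrix.mulVec_mulVec, Matrix.mul_nonsing_inv _ hdet, Matrix.one_mulVec,
      ← norm_neg (A⁻¹ *ᵥ ξ (1 - 0) ω)] at h6
  have h7 := ((hξ.identDistrib 0 (1 - 0)).comp
    (measurable_ofReal_posLog_norm (E := Fin n → ℂ))).lintegral_eq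
  exact h7.trans_lt h5

end Necessity

/-! ### Eigenvalues on the unit circle: the reduced noise is constant -/

section UnitModulus

variable {Ω : Type*} [MeasurableSpace Ω] {P : Measure Ω} {n : ℕ}

/-- Under the symmetrized law, 1 - cos(L x) is nonnegative with mean 1 - |φ(L)|² = 0. -/
theorem ae_cos_eq_one_of_norm_charFunDual_eq_one {ρ : Measure (Fin n → ℂ)}
    [IsProbabilityMeasure ρ] {L : StrongDual ℝ (Fin n → ℂ)} (h : ‖charFunDual ρ L‖ ^ 2 = 1) :
    ∀ᵐ x ∂(symmetrization ρ), Real.cos (L x) = 1 := by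
  have hint : Integrable (fun x => Complex.exp (L x * Complex.I)) (symmetrization ρ) := by
    refine Integrable.of_bound (C := 1) (by fun_prop) (Filter.Eventually.of_forall fun ω => ?_)
    rw [Complex.norm_exp_ofReal_mul_I]
  have h1 := charFunDual_symmetrization ρ L
  rw [h, charFunDual_apply] at h1
  have h2 : ∫ x, (1 - Real.cos (L x)) ∂(symmetrization ρ) = 0 := by
    have h3 : ∫ x, Real.cos (L x) ∂(symmetrization ρ) = 1 := by
      have h4 := congrArg Complex.re h1
      rw [← RCLike.re_eq_complex_re, ← integral_re hint] at h4
      simpa [Complex.exp_ofReal_mul_I_re] using h4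
    have hc : Integrable (fun x => Real.cos (L x)) (symmetrization ρ) :=
      Integrable.of_bound (C := 1) (by fun_prop)
        (Filter.Eventually.of_forall fun x => by simpa using Real.abs_cos_le_one _)
    rw [integral_sub (integrable_const _) hc, h3]; simp
  rw [integral_eq_zero_iff_of_nonneg (fun x => sub_nonneg.2 (Real.cos_le_one _))] at h2
  · filter_upwards [h2] with x hx
    have : 1 - Real.cos (L x) = 0 := hx
    linarith
  · exact Integrable.of_bound (C := 2)
      (by fun_prop : Continuous fun x => 1 - Real.cos (L x)).aestronglyMeasurable (Filter.Eventually.of_forall fun x => by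
      rw [Real.norm_eq_abs, abs_le]
      constructor <;> linarith [Real.cos_le_one (L x), Real.neg_one_le_cos (L x)])

/-- For large k the argument lies in (-2π, 2π), where cos equals 1 only at 0. -/
theorem eq_zero_of_forall_cos_eq_one {δ y : ℝ} (hδ : 0 < δ)
    (h : ∀ k : ℕ, Real.cos (δ / (k + 1) * y) = 1) : y = 0 := by
  obtain ⟨k, hk⟩ := exists_nat_gt (δ * |y| / (2 * Real.pi))
  have hpi := Real.pi_pos
  have hk1 : (0 : ℝ) < k + 1 := by positivity
  have h1 : |δ / (k + 1) * y| < 2 * Real.pi := by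
    rw [abs_mul, abs_of_pos (by positivity), div_mul_eq_mul_div, div_lt_iff₀ hk1]
    rw [div_lt_iff₀ (by positivity)] at hk
    nlinarith
  obtain ⟨h2, h3⟩ := abs_lt.1 h1
  have h4 := (Real.cos_eq_one_iff_of_lt_of_lt h2 h3).1 (h k)
  rcases mul_eq_zero.1 h4 with h5 | h5
  · exact absurd h5 (by positivity)
  · exact h5

/-- Once the coordinates before i vanish, coordinate i of Φ^j x is λ^j x_i, so the summands depend
only on the rotated functionals z λ^j. They tend to 0 without the functionals shrinking, which
forces |φ| = 1 near the origin and hence x_i = 0. -/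
theorem ae_symmetrization_eq_zero {lam : ℂ} (hlam : ‖lam‖ = 1) {ρ : Measure (Fin n → ℂ)}
    [IsProbabilityMeasure ρ] {δ : ℝ} (hδ : 0 < δ)
    (h : ∀ L : StrongDual ℝ (Fin n → ℂ), ‖L‖ ≤ δ → ∀ k : ℕ, ∑ j ∈ Finset.range k,
      (1 - ‖charFunDual ρ (L.comp (mulVecCLM (jordanBlock n lam ^ j)))‖ ^ 2) ≤ 2) :
    ∀ᵐ x ∂(symmetrization ρ), x = 0 := by
  suffices hs : ∀ k : ℕ, ∀ i : Fin n, (i : ℕ) = k → ∀ᵐ x ∂(symmetrization ρ), x i = 0 by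
    have h1 : ∀ᵐ x ∂(symmetrization ρ), ∀ i, x i = 0 := ae_all_iff.2 fun i => hs i i rfl
    filter_upwards [h1] with x hx
    exact funext hx
  intro k
  induction k using Nat.strong_induction_on with
  | _ k ih =>
  intro i hi
  have hprev : ∀ᵐ x ∂(symmetrization ρ), ∀ l < i, x l = 0 := by
    refine ae_all_iff.2 fun l => ?_
    by_cases hl : l < i
    · filter_upwards [ih l (by have := Fin.lt_def.1 hl; omega) l rfl] with x hx _
      exact hx
    · exact Filter.Eventually.of_forall fun x hl' => absurd hl' hl
  have hchar (z : ℂ) (j : ℕ) :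
      ‖charFunDual ρ ((coordRe i z).comp (mulVecCLM (jordanBlock n lam ^ j)))‖ ^ 2 =
        ‖charFunDual ρ (coordRe i (z * lam ^ j))‖ ^ 2 := by
    -- The earlier coordinates vanish under the symmetrized law, not under ρ, so the comparison goes
    -- through |φ|².
    have h1 : charFunDual (symmetrization ρ)
        ((coordRe i z).comp (mulVecCLM (jordanBlock n lam ^ j))) =
        charFunDual (symmetrization ρ) (coordRe i (z * lam ^ j)) := by
      rw [charFunDual_apply, charFunDual_apply]
      refine integral_congr_ae ?_
      filter_upwards [hprev] with x hx
      have h2 : (coordRe i z).comp (mulVecCLM (jordanBlock n lam ^ j)) x =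
          coordRe i (z * lam ^ j) x := by
        rw [ContinuousLinearMap.comp_apply, mulVecCLM_apply, coordRe_apply, coordRe_apply,
          jordanBlock_pow_mulVec lam x i hx, mul_assoc]
      rw [h2]
    rw [charFunDual_symmetrization, charFunDual_symmetrization] at h1
    exact_mod_cast h1
  have hcont : Continuous fun z : ℂ => ‖charFunDual ρ (coordRe i z)‖ ^ 2 := by
    have h1 : (fun z : ℂ => charFunDual ρ (coordRe i z)) =
        fun z : ℂ => charFun (ρ.map fun x => x i) ((starRingEnd ℂ) z) := by
      ext z
      rw [charFunDual_apply, charFun_apply, integral_map (measurable_pi_apply i).aemeasurable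
        (by fun_prop)]
      refine integral_congr_ae (Filter.Eventually.of_forall fun x => ?_)
      simp only [coordRe_apply, Complex.inner]
      congr 3
      simp
    have := Measure.isProbabilityMeasure_map (μ := ρ) (f := fun x : Fin n → ℂ => x i)
      (measurable_pi_apply i).aemeasurable
    have h2 : Continuous fun z : ℂ => charFunDual ρ (coordRe i z) := by
      rw [h1]
      exact continuous_charFun.comp Complex.continuous_conj
    exact h2.norm.pow 2
  -- The powers λ^j need not converge; a limit point ν on the circle is enough.
  obtain ⟨ν, hν, φ, hφ, hlim⟩ := (isCompact_sphere (0 : ℂ) 1).tendsto_subseq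
    (x := fun j => lam ^ j) fun j => by simp [hlam]
  have hν1 : ‖ν‖ = 1 := by simpa using hν
  have hν0 : ν ≠ 0 := norm_pos_iff.1 (by rw [hν1]; exact one_pos)
  have hone (z : ℂ) (hz : ‖z‖ ≤ δ) : ‖charFunDual ρ (coordRe i z)‖ ^ 2 = 1 := by
    -- Chosen so that z' λ^j tends to z along the subsequence.
    set z' := z * ν⁻¹ with hz'
    have hz'δ : ‖coordRe i z'‖ ≤ δ := by
      refine (norm_coordRe_le i z').trans ?_
      rw [hz', norm_mul, norm_inv, hν1, inv_one, mul_one]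
      exact hz
    have hb (j : ℕ) : 0 ≤ 1 - ‖charFunDual ρ (coordRe i (z' * lam ^ j))‖ ^ 2 := by
      have h3 : ‖charFunDual ρ (coordRe i (z' * lam ^ j))‖ ≤ 1 := by
        have := Measure.isProbabilityMeasure_map (μ := ρ) (f := coordRe i (z' * lam ^ j))
          (by fun_prop)
        rw [charFunDual_eq_charFun_map_one]
        exact norm_charFun_le_one _
      have := pow_le_one₀ (n := 2) (norm_nonneg _) h3
      linarith
    have hsum : Summable fun j : ℕ => 1 - ‖charFunDual ρ (coordRe i (z' * lam ^ j))‖ ^ 2 := by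
      refine summable_of_sum_range_le hb (c := 2) fun k => ?_
      have := h (coordRe i z') hz'δ k
      simpa only [hchar] using this
    have h4 := hsum.tendsto_atTop_zero.comp hφ.tendsto_atTop
    have h5 : Filter.Tendsto (fun j => 1 - ‖charFunDual ρ (coordRe i (z' * lam ^ φ j))‖ ^ 2)
        Filter.atTop (nhds (1 - ‖charFunDual ρ (coordRe i (z' * ν))‖ ^ 2)) :=
      tendsto_const_nhds.sub ((hcont.tendsto _).comp (hlim.const_mul z'))
    have h6 := tendsto_nhds_unique h5 h4
    rw [hz', mul_assoc, inv_mul_cancel₀ hν0, mul_one] at h6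
    linarith
  have hcos (z : ℂ) (hz : ‖z‖ ≤ 1) : ∀ᵐ x ∂(symmetrization ρ), (z * x i).re = 0 := by
    have h1 : ∀ᵐ x ∂(symmetrization ρ), ∀ k : ℕ,
        Real.cos (coordRe i (((δ / (k + 1) : ℝ) : ℂ) * z) x) = 1 := by
      refine ae_all_iff.2 fun k => ae_cos_eq_one_of_norm_charFunDual_eq_one (hone _ ?_)
      rw [norm_mul, Complex.norm_real, Real.norm_eq_abs, abs_of_pos (by positivity)]
      have h2 : δ / (k + 1) ≤ δ := div_le_self hδ.le (by simp)
      calc δ / (k + 1) * ‖z‖ ≤ δ * 1 := mul_le_mul h2 hz (norm_nonneg _) hδ.le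
        _ = δ := mul_one δ
    filter_upwards [h1] with x hx
    refine eq_zero_of_forall_cos_eq_one hδ fun k => ?_
    have := hx k
    rwa [coordRe_apply, mul_assoc, Complex.re_ofReal_mul] at this
  filter_upwards [hcos 1 (by simp), hcos (-Complex.I) (by simp)] with x h1 h2
  refine Complex.ext ?_ ?_
  · simpa using h1
  · simpa using h2

/-- By Fubini, two independent copies that agree almost surely agree with one fixed value of the
first copy. -/
theorem exists_ae_eq_const_of_symmetrization {X : Ω → (Fin n → ℂ)} [IsProbabilityMeasure P]
    (hX : Measurable X) (h : ∀ᵐ x ∂(symmetrization (P.map X)), x = 0) :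
    ∃ α, ∀ᵐ ω ∂P, X ω = α := by
  have := Measure.isProbabilityMeasure_map (μ := P) hX.aemeasurable
  have hm : Measurable fun x : (Fin n → ℂ) × (Fin n → ℂ) => x.1 - x.2 :=
    measurable_fst.sub measurable_snd
  have h1 : ∀ᵐ x ∂((P.map X).prod (P.map X)), x.1 - x.2 = 0 := ae_of_ae_map hm.aemeasurable h
  obtain ⟨α, hα⟩ := (Measure.ae_ae_of_ae_prod h1).exists
  refine ⟨α, ?_⟩
  filter_upwards [ae_of_ae_map hX.aemeasurable hα] with ω hω
  exact (sub_eq_zero.1 hω).symm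

theorem exists_ae_eq_const_of_recursion [IsProbabilityMeasure P] {lam : ℂ} (hlam : ‖lam‖ = 1)
    {w ξ : ℤ → Ω → (Fin n → ℂ)} (hw : ∀ t, Measurable (w t)) (hT : UniformlyTight w P)
    (hξ : IsIID ξ P)
    (hrec : ∀ t, ∀ᵐ ω ∂P, w t ω = jordanBlock n lam *ᵥ w (t - 1) ω + ξ t ω) :
    ∃ α, ∀ t, ∀ᵐ ω ∂P, ξ t ω = α := by
  obtain ⟨δ, hδ, h⟩ := exists_sum_one_sub_charFunDual_le (jordanBlock_sub_smul_one_pow lam)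
    hlam.le hw hT hξ hrec
  have := Measure.isProbabilityMeasure_map (μ := P) (hξ.measurable 0).aemeasurable
  obtain ⟨α, hα⟩ := exists_ae_eq_const_of_symmetrization (hξ.measurable 0)
    (ae_symmetrization_eq_zero hlam hδ h)
  exact ⟨α, fun t => (hξ.identDistrib 0 t).ae_snd (p := fun x => x = α)
    (measurableSet_singleton α) hα⟩

/-- Nothing feeds the first coordinate of the block, so it grows by α_i at each step: its increment
over k steps is k α_i, which is tight only if α_i = 0. -/
theorem apply_first_eq_zero_of_recursion [IsProbabilityMeasure P]
    {w : ℤ → Ω → (Fin n → ℂ)} (hw : ∀ t, Measurable (w t)) (hT : UniformlyTight w P)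
    {α : Fin n → ℂ}
    (hrec : ∀ t, ∀ᵐ ω ∂P, w t ω = jordanBlock n 1 *ᵥ w (t - 1) ω + α)
    {i : Fin n} (hi : (i : ℕ) = 0) : α i = 0 := by
  have hT' : UniformlyTight (fun t ω => w t ω i) P :=
    hT.of_norm_le id (C := 1) fun t => Filter.Eventually.of_forall fun ω => by
      rw [one_mul]; exact norm_le_pi_norm _ i
  have hTk : UniformlyTight (fun (k : ℕ) ω => w k ω i - w 0 ω i) P :=
    (hT'.comp fun k : ℕ => (k : ℤ)).sub (hT'.comp fun _ : ℕ => (0 : ℤ))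
      fun k => ((measurable_pi_apply i).comp (hw _)).aemeasurable
  refine hTk.eq_zero_of_nsmul fun k => ?_
  induction k with
  | zero => simp
  | succ k ih =>
    filter_upwards [ih, hrec ((k + 1 : ℕ) : ℤ)] with ω h1 h2
    have h3 : ((k + 1 : ℕ) : ℤ) - 1 = k := by push_cast; ring
    have h4 := congrFun h2 i
    rw [h3, Pi.add_apply, jordanBlock_mulVec, dif_neg (by omega), add_zero, one_mul] at h4
    rw [h4, add_sub_right_comm, h1]
    push_cast
    rw [add_smul, one_smul]

end UnitModulus

/-! ### Convergence of the series -/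

section Series

variable {Ω : Type*} [MeasurableSpace Ω] {P : Measure Ω} {n d q : ℕ}

/-- By Borel–Cantelli, ‖η_j‖ ≤ σ^j eventually, against decay of order ρ^j. Only the common law of
the η_j matters, not their independence. -/
theorem ae_summable_norm_pow_mulVec [IsProbabilityMeasure P] {A : Matrix (Fin n) (Fin n) ℂ}
    {μ : ℂ} {N : ℕ} (hA : (A - μ • 1) ^ N = 0) (hμ : ‖μ‖ < 1) {X : Ω → (Fin n → ℂ)}
    (hX : ∫⁻ ω, ENNReal.ofReal (Real.posLog ‖X ω‖) ∂P < ⊤) {η : ℕ → Ω → (Fin n → ℂ)}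
    (hη : ∀ j, IdentDistrib (η j) X P P) :
    ∀ᵐ ω ∂P, Summable fun j => ‖A ^ j *ᵥ η j ω‖ := by
  obtain ⟨ρ, hμρ, hρ1⟩ := exists_between hμ
  have hρ0 : 0 < ρ := (norm_nonneg μ).trans_lt hμρ
  obtain ⟨C, hC, hle⟩ := exists_norm_pow_mulVec_le hA hμρ
  -- Any σ in (1, 1/ρ) gives the convergent majorant C (ρσ)^j.
  obtain ⟨σ, hσ1, hσ⟩ := exists_between ((one_lt_inv₀ hρ0).2 hρ1)
  have hρσ : ρ * σ < 1 := by
    have := mul_lt_mul_of_pos_left hσ hρ0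
    rwa [mul_inv_cancel₀ hρ0.ne'] at this
  have hXm : AEMeasurable X P := (hη 0).aemeasurable_snd
  have := Measure.isProbabilityMeasure_map hXm
  rw [← lintegral_map' (f := fun x => ENNReal.ofReal (Real.posLog ‖x‖))
    measurable_ofReal_posLog_norm.aemeasurable hXm] at hX
  have hs := tsum_measure_pow_lt_ne_top hσ1 hX
  have hs' : ∑' j : ℕ, P {ω | σ ^ j < ‖η j ω‖} ≠ ⊤ := by
    rw [tsum_congr fun j => ?_] at hs
    · exact hs
    have hm : MeasurableSet {x : Fin n → ℂ | σ ^ j < ‖x‖} :=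
      measurableSet_lt measurable_const measurable_norm
    rw [← (hη j).map_eq, Measure.map_apply_of_aemeasurable (hη j).aemeasurable_fst hm]
    rfl
  filter_upwards [ae_eventually_notMem hs'] with ω hω
  refine Summable.of_norm_bounded_eventually_nat (g := fun j => C * (ρ * σ) ^ j)
    ((summable_geometric_of_lt_one (by positivity) hρσ).mul_left C) ?_
  filter_upwards [hω] with j hj
  have hj' : ‖η j ω‖ ≤ σ ^ j := not_lt.1 hj
  rw [norm_norm, mul_pow, ← mul_assoc]
  exact (hle j _).trans (mul_le_mul_of_nonneg_left hj' (by positivity))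

end Series

/-! ### The block processes -/

section BlockProcess

variable {Ω : Type*} {n d q : ℕ} {A : Matrix (Fin n) (Fin n) ℂ}
  {B : Fin (q + 1) → Matrix (Fin n) (Fin d) ℂ} {Z : ℤ → Ω → (Fin d → ℂ)}

theorem pastTerm_eq_finiteTerm (hA : IsUnit A) (t : ℤ) (j : ℕ) (ω : Ω) :
    pastTerm A B Z t j ω = finiteTerm A B Z t j ω := by
  have hdet := (Matrix.isUnit_iff_isUnit_det A).1 hA
  rw [pastTerm, finiteTerm, Matrix.mul_sum]
  congr 1
  refine Finset.sum_congr rfl fun k hk => ?_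
  have hk' := (Finset.mem_filter.1 hk).2
  rw [← Matrix.mul_assoc, ← zpow_natCast, ← Matrix.zpow_add hdet, ← zpow_natCast]
  congr 2
  push_cast [Nat.cast_sub hk', Nat.cast_sub (show (k : ℕ) ≤ q by omega)]
  ring

/-- The sum over k ≥ q - i is the full sum minus that over k ≤ q - 1 - i. The full sum gives the
backward series; the complement is the summand of `recentNoise` at lag q - 1 - i. -/
theorem futureTerm_eq (hA : IsUnit A) (t : ℤ) (i : ℕ) (ω : Ω) :
    futureTerm A B Z t ((i : ℤ) + 1 - (q : ℤ)) ω =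
      A⁻¹ ^ (i + 1) *ᵥ (momentMatrix A B *ᵥ Z (t + i + 1 - q) ω) -
        if i < q then finiteTerm A B Z t (q - 1 - i) ω else 0 := by
  have hdet := (Matrix.isUnit_iff_isUnit_det A).1 hA
  have hexp : A ^ (-((i : ℤ) + 1 - (q : ℤ)) - (q : ℤ)) = A⁻¹ ^ (i + 1) := by
    rw [← zpow_natCast, Matrix.inv_zpow, ← Matrix.zpow_neg hdet]
    congr 1
    push_cast
    ring
  have hZ : t + ((i : ℤ) + 1 - (q : ℤ)) = t + i + 1 - q := by ring
  have hsplit : momentMatrix A B =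
      (∑ k : Fin (q + 1) with 1 - ((i : ℤ) + 1 - (q : ℤ)) ≤ (k.val : ℤ), A ^ (q - (k : ℕ)) * B k) +
      ∑ k : Fin (q + 1) with ¬ 1 - ((i : ℤ) + 1 - (q : ℤ)) ≤ (k.val : ℤ),
        A ^ (q - (k : ℕ)) * B k :=
    (Finset.sum_filter_add_sum_filter_not _ _ _).symm
  rw [futureTerm, hexp, hZ, eq_sub_iff_add_eq, Matrix.mulVec_mulVec, hsplit, Matrix.mul_add,
    Matrix.add_mulVec]
  congr 1
  split_ifs with hi
  · have ht : t - ((q - 1 - i : ℕ) : ℤ) = t + i + 1 - q := by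
      have : ((q - 1 - i : ℕ) : ℤ) = q - 1 - i := by omega
      rw [this]; ring
    rw [finiteTerm, ht, Matrix.mul_sum]
    congr 1
    refine Finset.sum_congr (Finset.filter_congr fun k _ => by omega) fun k hk => ?_
    have hk' : (k : ℕ) ≤ q - 1 - i := by
      have := (Finset.mem_filter.1 hk).2
      omega
    have hpow : A ^ (q - (k : ℕ)) = A ^ (i + 1) * A ^ (q - 1 - i - (k : ℕ)) := by
      rw [← pow_add]
      congr 1
      omega
    rw [hpow, ← Matrix.mul_assoc, ← Matrix.mul_assoc, Matrix.inv_pow', Matrix.nonsing_inv_mul _ (by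
      rw [Matrix.det_pow]; exact hdet.pow _), Matrix.one_mul]
  · rw [Finset.filter_false_of_mem (fun k _ => by omega), Finset.sum_empty, Matrix.mul_zero,
      Matrix.zero_mulVec]

theorem finiteTerm_add (t : ℤ) (i : ℕ) (ω : Ω) :
    finiteTerm A B Z t (q + i) ω = A ^ i *ᵥ (momentMatrix A B *ᵥ Z (t - q - i) ω) := by
  rw [finiteTerm_eq, noiseCoeff_add, Matrix.mulVec_mulVec]
  congr 2
  push_cast
  ring

theorem sub_mulVec_eq_sum_iff {X : ℤ → Ω → (Fin n → ℂ)} {t : ℤ} {ω : Ω} :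
    X t ω - A *ᵥ X (t - 1) ω = ∑ k : Fin (q + 1), B k *ᵥ Z (t - (k : ℕ)) ω ↔
      X t ω - recentNoise A B Z t ω =
        A *ᵥ (X (t - 1) ω - recentNoise A B Z (t - 1) ω) + momentMatrix A B *ᵥ Z (t - q) ω := by
  have h := recentNoise_sub A B Z t ω
  rw [Matrix.mulVec_sub, ← sub_eq_zero, ← sub_eq_zero (a := X t ω - _)]
  rw [eq_sub_iff_add_eq] at h
  rw [← h]
  refine Eq.congr_left ?_
  abel

theorem blockSolution_add (m : ℕ) (lam : ℂ) (f : Fin n → ℂ) (t s : ℤ) (ω : Ω) :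
    blockSolution m lam B f Z (t + s) ω = blockSolution m lam B f (fun u => Z (u + s)) t ω := by
  have h1 (j : ℤ) : t + s - j = t - j + s := by ring
  have h2 (j : ℤ) : t + s + j = t + j + s := by ring
  simp only [blockSolution, finiteTerm, pastTerm, futureTerm, h1, h2]

theorem summable_futureTerm {lam : ℂ} (h0 : lam ≠ 0) {t : ℤ} {ω : Ω}
    (h : Summable fun i : ℕ => ‖(jordanBlock n lam)⁻¹ ^ i *ᵥ
      (momentMatrix (jordanBlock n lam) B *ᵥ Z (t - q + i) ω)‖) :
    Summable fun i : ℕ => ‖futureTerm (jordanBlock n lam) B Z t ((i : ℤ) + 1 - (q : ℤ)) ω‖ := by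
  rw [← summable_nat_add_iff q]
  have h2 := (summable_nat_add_iff (q + 1)).2 h
  refine h2.congr fun i => ?_
  have hZ : t + ((i + q : ℕ) : ℤ) + 1 - q = t - q + ((i + (q + 1) : ℕ) : ℤ) := by
    push_cast; ring
  rw [futureTerm_eq (isUnit_jordanBlock h0), if_neg (by omega), sub_zero, hZ, add_assoc]

/-- After removal of `recentNoise` the solution is a sum over i < m of Φ^i M Z_{t-q-i}. Since Φ^m =
0 by n ≤ m, applying Φ and adding the new noise merely shifts the index. -/
theorem blockSolution_sub_eq_of_zero {m : ℕ} (hnm : n ≤ m) (f : Fin n → ℂ) (t : ℤ) (ω : Ω) :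
    blockSolution m 0 B f Z t ω - jordanBlock n 0 *ᵥ blockSolution m 0 B f Z (t - 1) ω =
      ∑ k : Fin (q + 1), B k *ᵥ Z (t - (k : ℕ)) ω := by
  have hsol (t : ℤ) : blockSolution m 0 B f Z t ω - recentNoise (jordanBlock n 0) B Z t ω =
      ∑ i ∈ Finset.range m, jordanBlock n 0 ^ i *ᵥ
        (momentMatrix (jordanBlock n 0) B *ᵥ Z (t - q - i) ω) := by
    rw [blockSolution, if_pos rfl, add_comm m q, Finset.sum_range_add, recentNoise,
      add_sub_cancel_left]
    exact Finset.sum_congr rfl fun i _ => finiteTerm_add t i ω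
  rw [sub_mulVec_eq_sum_iff, hsol, hsol, Matrix.mulVec_sum]
  have h1 := Finset.sum_range_succ (fun i => jordanBlock n 0 ^ i *ᵥ
    (momentMatrix (jordanBlock n 0) B *ᵥ Z (t - q - i) ω)) m
  rw [jordanBlock_zero_pow hnm, Matrix.zero_mulVec, add_zero] at h1
  rw [← h1, Finset.sum_range_succ']
  congr 1
  · refine Finset.sum_congr rfl fun i _ => ?_
    rw [Matrix.mulVec_mulVec (M := jordanBlock n 0), ← pow_succ']
    congr 3
    push_cast
    ring
  · simp

variable [MeasurableSpace Ω]

theorem measurable_blockSolution (m : ℕ) (lam : ℂ) (f : Fin n → ℂ) (hZ : ∀ t, Measurable (Z t))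
    (t : ℤ) : Measurable (blockSolution m lam B f Z t) := by
  have hfin (j : ℕ) : Measurable (finiteTerm (jordanBlock n lam) B Z t j) :=
    (measurable_mulVec _).comp (hZ _)
  unfold blockSolution
  split_ifs
  · exact Finset.measurable_fun_sum _ fun j _ => hfin j
  · exact Measurable.tsum fun j => (measurable_mulVec _).comp (hZ _)
  · exact (Finset.measurable_fun_sum _ fun j _ => hfin j).const_add f
  · exact (Measurable.tsum fun j => (measurable_mulVec _).comp (hZ _)).neg

theorem measurable_recentNoise (hZ : ∀ t, Measurable (Z t)) (t : ℤ) :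
    Measurable (recentNoise A B Z t) :=
  Finset.measurable_fun_sum _ fun _ _ => (measurable_mulVec _).comp (hZ _)

variable {P : Measure Ω}

theorem IsIID.mulVec {l : ℕ} (hZ : IsIID Z P) (M : Matrix (Fin l) (Fin d) ℂ) (s : ℤ) :
    IsIID (fun t ω => M *ᵥ Z (t - s) ω) P where
  measurable t := (measurable_mulVec M).comp (hZ.measurable _)
  indep := by
    have h1 : iIndepFun (fun t : ℤ => Z (t - s)) P :=
      hZ.indep.precomp (g := fun t : ℤ => t - s) fun a b hab => by simpa using hab
    exact h1.comp (fun _ x => M *ᵥ x) fun _ => measurable_mulVec M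
  identDistrib t u := (hZ.identDistrib _ _).comp (measurable_mulVec M)

theorem IsIID.uniformlyTight_recentNoise [IsProbabilityMeasure P] (hZ : IsIID Z P) :
    UniformlyTight (recentNoise A B Z) P := by
  refine UniformlyTight.sum (Finset.range q) (fun j _ => UniformlyTight.of_identDistrib
    fun s t => (hZ.identDistrib _ _).comp (measurable_mulVec _))
    fun j _ t => ((measurable_mulVec _).comp (hZ.measurable _)).aemeasurable

theorem ae_summable_pastTerm [IsProbabilityMeasure P] {lam : ℂ} (h0 : lam ≠ 0) (h1 : ‖lam‖ < 1)
    {B : Fin (q + 1) → Matrix (Fin n) (Fin d) ℂ} (hZ : IsIID Z P)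
    (hlog : ∫⁻ ω, ENNReal.ofReal
      (Real.posLog ‖momentMatrix (jordanBlock n lam) B *ᵥ Z 0 ω‖) ∂P < ⊤) (t : ℤ) :
    ∀ᵐ ω ∂P, Summable fun j => ‖pastTerm (jordanBlock n lam) B Z t j ω‖ := by
  filter_upwards [ae_summable_norm_pow_mulVec (jordanBlock_sub_smul_one_pow lam) h1 hlog
    (η := fun j ω => momentMatrix (jordanBlock n lam) B *ᵥ Z (t - q - j) ω)
    fun j => (hZ.identDistrib _ _).comp (measurable_mulVec _)] with ω hω
  rw [← summable_nat_add_iff q]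
  refine hω.congr fun j => ?_
  rw [pastTerm_eq_finiteTerm (isUnit_jordanBlock h0), add_comm, finiteTerm_add]

theorem ae_summable_inv_pow_mulVec [IsProbabilityMeasure P] {lam : ℂ} (h1 : 1 < ‖lam‖)
    {B : Fin (q + 1) → Matrix (Fin n) (Fin d) ℂ} (hZ : IsIID Z P)
    (hlog : ∫⁻ ω, ENNReal.ofReal
      (Real.posLog ‖momentMatrix (jordanBlock n lam) B *ᵥ Z 0 ω‖) ∂P < ⊤) (t : ℤ) :
    ∀ᵐ ω ∂P, Summable fun i : ℕ => ‖(jordanBlock n lam)⁻¹ ^ i *ᵥ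
      (momentMatrix (jordanBlock n lam) B *ᵥ Z (t + i) ω)‖ := by
  have h0 : lam ≠ 0 := norm_pos_iff.1 (by linarith)
  exact ae_summable_norm_pow_mulVec (inv_sub_smul_one_pow_eq_zero
    (jordanBlock_sub_smul_one_pow lam) (isUnit_jordanBlock h0) h0)
    (by rw [norm_inv]; exact inv_lt_one_of_one_lt₀ h1) hlog
    (η := fun i ω => momentMatrix (jordanBlock n lam) B *ᵥ Z (t + i) ω)
    fun j => (hZ.identDistrib _ _).comp (measurable_mulVec _)

theorem ae_blockSolution_eq_of_lt_one [IsProbabilityMeasure P] {lam : ℂ} (h0 : lam ≠ 0)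
    (h1 : ‖lam‖ < 1) (m : ℕ) (f : Fin n → ℂ) (hZ : IsIID Z P)
    (hlog : ∫⁻ ω, ENNReal.ofReal
      (Real.posLog ‖momentMatrix (jordanBlock n lam) B *ᵥ Z 0 ω‖) ∂P < ⊤) (t : ℤ) :
    ∀ᵐ ω ∂P, blockSolution m lam B f Z t ω -
        jordanBlock n lam *ᵥ blockSolution m lam B f Z (t - 1) ω =
      ∑ k : Fin (q + 1), B k *ᵥ Z (t - (k : ℕ)) ω := by
  filter_upwards [ae_summable_pastTerm h0 h1 hZ hlog t,
    ae_summable_pastTerm h0 h1 hZ hlog (t - 1)] with ω hs hs'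
  have hsol (t : ℤ) (hs : Summable fun j => ‖pastTerm (jordanBlock n lam) B Z t j ω‖) :
      blockSolution m lam B f Z t ω - recentNoise (jordanBlock n lam) B Z t ω =
      ∑' i : ℕ, jordanBlock n lam ^ i *ᵥ
        (momentMatrix (jordanBlock n lam) B *ᵥ Z (t - q - i) ω) := by
    rw [blockSolution, if_neg h0, if_pos h1, ← hs.of_norm.sum_add_tsum_nat_add q, recentNoise]
    simp only [pastTerm_eq_finiteTerm (isUnit_jordanBlock h0)]
    rw [add_sub_cancel_left]
    exact tsum_congr fun i => by rw [add_comm, finiteTerm_add]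
  have hsum (t : ℤ) (hs : Summable fun j => ‖pastTerm (jordanBlock n lam) B Z t j ω‖) :
      Summable fun i : ℕ => jordanBlock n lam ^ i *ᵥ
        (momentMatrix (jordanBlock n lam) B *ᵥ Z (t - q - i) ω) := by
    refine ((summable_nat_add_iff q).2 hs.of_norm).congr fun i => ?_
    rw [pastTerm_eq_finiteTerm (isUnit_jordanBlock h0), add_comm, finiteTerm_add]
  rw [sub_mulVec_eq_sum_iff, hsol t hs, hsol (t - 1) hs', (hsum t hs).tsum_eq_zero_add, add_comm,
    ← mulVecCLM_apply (jordanBlock n lam), (mulVecCLM _).map_tsum (hsum (t - 1) hs')]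
  congr 1
  · refine tsum_congr fun i => ?_
    rw [mulVecCLM_apply, Matrix.mulVec_mulVec (M := jordanBlock n lam), ← pow_succ']
    congr 3
    push_cast
    ring
  · simp

/-- The reduced process is -∑_{i ≥ 1} Φ^{-i} M Z_{t-q+i}. Applying Φ to its value at t - 1 releases
the term -M Z_{t-q}, which cancels the noise. -/
theorem ae_blockSolution_eq_of_one_lt [IsProbabilityMeasure P] {lam : ℂ}
    (h1 : 1 < ‖lam‖) (m : ℕ) (f : Fin n → ℂ) (hZ : IsIID Z P)
    (hlog : ∫⁻ ω, ENNReal.ofReal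
      (Real.posLog ‖momentMatrix (jordanBlock n lam) B *ᵥ Z 0 ω‖) ∂P < ⊤) (t : ℤ) :
    ∀ᵐ ω ∂P, blockSolution m lam B f Z t ω -
        jordanBlock n lam *ᵥ blockSolution m lam B f Z (t - 1) ω =
      ∑ k : Fin (q + 1), B k *ᵥ Z (t - (k : ℕ)) ω := by
  have h0 : lam ≠ 0 := norm_pos_iff.1 (by linarith)
  have hu := isUnit_jordanBlock (n := n) h0
  have hdet := (Matrix.isUnit_iff_isUnit_det _).1 hu
  filter_upwards [ae_summable_inv_pow_mulVec h1 hZ hlog (t - q),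
    ae_summable_inv_pow_mulVec h1 hZ hlog (t - 1 - q)] with ω hs hs'
  have hsol (t : ℤ) (hs : Summable fun i : ℕ => ‖(jordanBlock n lam)⁻¹ ^ i *ᵥ
      (momentMatrix (jordanBlock n lam) B *ᵥ Z (t - q + i) ω)‖) :
      blockSolution m lam B f Z t ω - recentNoise (jordanBlock n lam) B Z t ω =
      -∑' i : ℕ, (jordanBlock n lam)⁻¹ ^ (i + 1) *ᵥ
        (momentMatrix (jordanBlock n lam) B *ᵥ Z (t - q + (i + 1 : ℕ)) ω) := by
    have hs1 := (summable_nat_add_iff 1).2 hs.of_norm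
    -- The correction terms of `futureTerm_eq` run through `recentNoise` in reversed order.
    have hfin : ∑' i : ℕ, (if i < q then finiteTerm (jordanBlock n lam) B Z t (q - 1 - i) ω
        else 0) = recentNoise (jordanBlock n lam) B Z t ω := by
      rw [tsum_eq_sum (s := Finset.range q) fun i hi => if_neg (by simpa using hi), recentNoise,
        ← Finset.sum_range_reflect (fun j => finiteTerm (jordanBlock n lam) B Z t j ω)]
      exact Finset.sum_congr rfl fun i hi => if_pos (Finset.mem_range.1 hi)
    rw [blockSolution, if_neg h0, if_neg h1.le.not_gt, if_neg h1.ne', ← hfin, ← neg_add',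
      ← Summable.tsum_add (summable_futureTerm h0 hs).of_norm
        (summable_of_hasFiniteSupport ((Finset.range q).finite_toSet.subset fun i hi => by
          by_contra hcon
          exact hi (if_neg (by simpa using hcon))))]
    congr 1
    refine tsum_congr fun i => ?_
    rw [futureTerm_eq hu, sub_add_cancel]
    congr 3
    push_cast
    ring
  have hz : t - 1 - (q : ℤ) + ((0 + 1 : ℕ) : ℤ) = t - q := by push_cast; ring
  have hstep (i : ℕ) : mulVecCLM (jordanBlock n lam) ((jordanBlock n lam)⁻¹ ^ (i + 1) *ᵥ
        (momentMatrix (jordanBlock n lam) B *ᵥ Z (t - 1 - q + (i + 1 : ℕ)) ω)) =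
      (jordanBlock n lam)⁻¹ ^ i *ᵥ
        (momentMatrix (jordanBlock n lam) B *ᵥ Z (t - q + i) ω) := by
    rw [mulVecCLM_apply, Matrix.mulVec_mulVec (M := jordanBlock n lam), pow_succ',
      ← Matrix.mul_assoc, Matrix.mul_nonsing_inv _ hdet, Matrix.one_mul]
    congr 3
    push_cast
    ring
  rw [sub_mulVec_eq_sum_iff, hsol t hs, hsol (t - 1) hs', Matrix.mulVec_neg,
    ← mulVecCLM_apply (jordanBlock n lam),
    (mulVecCLM _).map_tsum ((summable_nat_add_iff 1).2 hs'.of_norm), tsum_congr hstep,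
    hs.of_norm.tsum_eq_zero_add]
  simp

theorem ae_blockSolution_eq_of_norm_eq_one {lam : ℂ} (h1 : ‖lam‖ = 1) (m : ℕ) {f α : Fin n → ℂ}
    (hf : (1 - jordanBlock n lam) *ᵥ f = α) (hZ : IsIID Z P)
    (hα : ∀ᵐ ω ∂P, momentMatrix (jordanBlock n lam) B *ᵥ Z 0 ω = α) (t : ℤ) :
    ∀ᵐ ω ∂P, blockSolution m lam B f Z t ω -
        jordanBlock n lam *ᵥ blockSolution m lam B f Z (t - 1) ω =
      ∑ k : Fin (q + 1), B k *ᵥ Z (t - (k : ℕ)) ω := by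
  have h0 : lam ≠ 0 := norm_pos_iff.1 (by rw [h1]; exact one_pos)
  have hα' := ((hZ.identDistrib 0 (t - q)).comp
    (measurable_mulVec (momentMatrix (jordanBlock n lam) B))).ae_snd (p := fun x => x = α)
    (measurableSet_singleton α) hα
  filter_upwards [hα'] with ω hω
  have hsol (t : ℤ) :
      blockSolution m lam B f Z t ω - recentNoise (jordanBlock n lam) B Z t ω = f := by
    rw [blockSolution, if_neg h0, if_neg (by rw [h1]; exact lt_irrefl _), if_pos h1, recentNoise,
      add_sub_cancel_right]
  have hω' : momentMatrix (jordanBlock n lam) B *ᵥ Z (t - q) ω = α := hω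
  rw [sub_mulVec_eq_sum_iff, hsol, hsol, hω', ← hf, Matrix.sub_mulVec, Matrix.one_mulVec]
  abel

end BlockProcess

/-! ### Stationarity -/

section Stationarity

variable {Ω : Type*} [MeasurableSpace Ω] {P : Measure Ω} {m d : ℕ}

/-- A time shift of an equivariant functional can be moved to its input, whose law is invariant. -/
theorem isStrictlyStationary_of_shift {𝒲 : Type*} [MeasurableSpace 𝒲] {W : Ω → 𝒲}
    (hW : Measurable W) {F : ℤ → 𝒲 → (Fin m → ℂ)} (hF : ∀ t, Measurable (F t))
    {T : ℤ → 𝒲 → 𝒲} (hT : ∀ s, Measurable (T s))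
    (hmap : ∀ s, P.map (fun ω => T s (W ω)) = P.map W)
    (hFT : ∀ t s x, F (t + s) x = F t (T s x)) :
    IsStrictlyStationary (fun t ω => F t (W ω)) P where
  measurable t := (hF t).comp hW
  map_shift n t s := by
    have hG : Measurable fun (x : 𝒲) (i : Fin n) => F (t i) x := measurable_pi_lambda _ fun i => hF _
    have h1 : (fun ω i => F (t i + s) (W ω)) =
        (fun (x : 𝒲) (i : Fin n) => F (t i) x) ∘ fun ω => T s (W ω) := by
      ext ω i
      simp only [hFT, Function.comp]
    rw [h1, ← Measure.map_map hG (show Measurable fun ω => T s (W ω) from (hT s).comp hW), hmap, Measure.map_map hG hW]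
    rfl

theorem IsIID.map_shift {Z : ℤ → Ω → (Fin d → ℂ)} (hZ : IsIID Z P) (s : ℤ) :
    P.map (fun ω t => Z (t + s) ω) = P.map fun ω t => Z t ω := by
  have h1 : iIndepFun (fun t : ℤ => Z (t + s)) P :=
    hZ.indep.precomp (g := fun t : ℤ => t + s) fun a b hab => by simpa using hab
  rw [h1.map_fun_eq_infinitePi_map fun t => hZ.measurable _,
    hZ.indep.map_fun_eq_infinitePi_map hZ.measurable]
  congr 1
  ext1 t
  exact (hZ.identDistrib _ _).map_eq

theorem IsStrictlyStationary.identDistrib {Y : ℤ → Ω → (Fin m → ℂ)}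
    (hY : IsStrictlyStationary Y P) (s t : ℤ) : IdentDistrib (Y s) (Y t) P P where
  aemeasurable_fst := (hY.measurable s).aemeasurable
  aemeasurable_snd := (hY.measurable t).aemeasurable
  map_eq := by
    have h := congrArg (Measure.map fun x : Fin 1 → Fin m → ℂ => x 0)
      (hY.map_shift 1 (fun _ => t) (s - t))
    have hm : Measurable fun x : Fin 1 → Fin m → ℂ => x 0 := measurable_pi_apply 0
    rw [Measure.map_map hm (measurable_pi_lambda _ fun i => hY.measurable _),
      Measure.map_map hm (measurable_pi_lambda _ fun i => hY.measurable _)] at h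
    simpa [Function.comp_def] using h

end Stationarity

/-! ### Equivalence of norms on ℂ^s -/

theorem exists_seminorm_le {s : ℕ} (N : Seminorm ℂ (Fin s → ℂ)) :
    ∃ C : ℝ, 0 < C ∧ ∀ x, N x ≤ C * ‖x‖ := by
  refine ⟨∑ i, N (Pi.single i 1) + 1, add_pos_of_nonneg_of_pos
    (Finset.sum_nonneg fun i _ => apply_nonneg N _) one_pos, fun x => ?_⟩
  have h1 : x = ∑ i, x i • (Pi.single i 1 : Fin s → ℂ) := by
    ext j
    simp [Finset.sum_apply, Pi.single_apply]
  calc N x = N (∑ i, x i • (Pi.single i 1 : Fin s → ℂ)) := by rw [← h1]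
    _ ≤ ∑ i, N (x i • (Pi.single i 1 : Fin s → ℂ)) :=
        Finset.le_sum_of_subadditive N (map_zero N).le (map_add_le_add N) _ _
    _ ≤ ∑ i, N (Pi.single i 1) * ‖x‖ := by
        refine Finset.sum_le_sum fun i _ => ?_
        rw [map_smul_eq_mul, mul_comm]
        exact mul_le_mul_of_nonneg_left (norm_le_pi_norm x i) (apply_nonneg N _)
    _ ≤ (∑ i, N (Pi.single i 1) + 1) * ‖x‖ := by
        rw [← Finset.sum_mul]
        exact mul_le_mul_of_nonneg_right (by linarith) (norm_nonneg x)

theorem exists_le_seminorm {s : ℕ} {N : Seminorm ℂ (Fin s → ℂ)} (hN : ∀ x, N x = 0 → x = 0) :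
    ∃ C : ℝ, 0 < C ∧ ∀ x, ‖x‖ ≤ C * N x := by
  obtain ⟨K, hK, hKle⟩ := exists_seminorm_le N
  have hcont : Continuous N := by
    refine (LipschitzWith.of_dist_le_mul (K := K.toNNReal) fun x y => ?_).continuous
    rw [Real.dist_eq, dist_eq_norm, Real.coe_toNNReal K hK.le]
    exact (abs_sub_map_le_sub N x y).trans (hKle _)
  -- The sphere is empty exactly when s = 0.
  rcases (Metric.sphere (0 : Fin s → ℂ) 1).eq_empty_or_nonempty with he | hne
  · refine ⟨1, one_pos, fun x => ?_⟩
    by_cases hx : x = 0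
    · simp [hx]
    · have h1 : ((‖x‖⁻¹ : ℝ) : ℂ) • x ∈ Metric.sphere (0 : Fin s → ℂ) 1 := by
        rw [mem_sphere_zero_iff_norm, norm_smul, Complex.norm_real, norm_inv, norm_norm,
          inv_mul_cancel₀ (norm_ne_zero_iff.2 hx)]
      rw [he] at h1
      exact h1.elim
  · obtain ⟨y, hy, hmin⟩ := (isCompact_sphere (0 : Fin s → ℂ) 1).exists_isMinOn hne
      hcont.continuousOn
    have hy1 : ‖y‖ = 1 := by simpa using hy
    have hpos : 0 < N y := lt_of_le_of_ne (apply_nonneg N y) fun h0 => by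
      rw [hN y h0.symm, norm_zero] at hy1
      exact zero_ne_one hy1
    refine ⟨(N y)⁻¹, inv_pos.2 hpos, fun x => ?_⟩
    by_cases hx : x = 0
    · simp [hx]
    · have hx0 := norm_pos_iff.2 hx
      have h1 : ((‖x‖⁻¹ : ℝ) : ℂ) • x ∈ Metric.sphere (0 : Fin s → ℂ) 1 := by
        rw [mem_sphere_zero_iff_norm, norm_smul, Complex.norm_real, norm_inv, norm_norm,
          inv_mul_cancel₀ hx0.ne']
      have h2 : N y ≤ N (((‖x‖⁻¹ : ℝ) : ℂ) • x) := hmin h1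
      rw [map_smul_eq_mul, Complex.norm_real, norm_inv, norm_norm] at h2
      rw [← div_eq_inv_mul, le_div_iff₀ hpos]
      calc ‖x‖ * N y ≤ ‖x‖ * (‖x‖⁻¹ * N x) := mul_le_mul_of_nonneg_left h2 hx0.le
        _ = N x := by rw [← mul_assoc, mul_inv_cancel₀ hx0.ne', one_mul]

/-- V_t is Φ^k V_{t-k} if |λ| < 1 and Φ^{-k} V_{t+k} if |λ| > 1: a matrix tending to 0 applied to a
tight family. -/
theorem ae_eq_zero_of_homogeneous_recursion {Ω : Type*} [MeasurableSpace Ω] {P : Measure Ω}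
    {n : ℕ} {lam : ℂ} (h1 : ‖lam‖ ≠ 1) {V : ℤ → Ω → (Fin n → ℂ)} (hV : ∀ t, Measurable (V t))
    (hT : UniformlyTight V P)
    (hrec : ∀ t, ∀ᵐ ω ∂P, V t ω = jordanBlock n lam *ᵥ V (t - 1) ω) (t : ℤ) :
    V t =ᵐ[P] 0 := by
  rcases lt_or_gt_of_ne h1 with hlt | hgt
  · obtain ⟨ρ, hρ, hρ1⟩ := exists_between hlt
    obtain ⟨C, -, hC⟩ := exists_norm_pow_mulVec_le (jordanBlock_sub_smul_one_pow (n := n) lam) hρ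
    have hlim : Filter.Tendsto (fun k => C * ρ ^ k) Filter.atTop (nhds 0) := by
      simpa using (tendsto_pow_atTop_nhds_zero_of_lt_one ((norm_nonneg _).trans hρ.le) hρ1).const_mul C
    refine hT.ae_eq_zero (hV t).aemeasurable hlim (fun k => t - k) fun k => ?_
    filter_upwards [ae_eq_pow_mulVec_add (ξ := fun _ _ => 0)
      (fun t => by simpa using hrec t) k t] with ω hω
    rw [hω]
    simpa using hC k (V (t - k) ω)
  · have h0 : lam ≠ 0 := norm_pos_iff.1 (by linarith)
    have hu := isUnit_jordanBlock (n := n) h0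
    have hdet := (Matrix.isUnit_iff_isUnit_det _).1 hu
    obtain ⟨ρ, hρ, hρ1⟩ := exists_between
      (show ‖lam⁻¹‖ < 1 by rw [norm_inv]; exact inv_lt_one_of_one_lt₀ hgt)
    obtain ⟨C, -, hC⟩ := exists_norm_pow_mulVec_le (inv_sub_smul_one_pow_eq_zero
      (jordanBlock_sub_smul_one_pow (n := n) lam) hu h0) hρ
    have hlim : Filter.Tendsto (fun k => C * ρ ^ k) Filter.atTop (nhds 0) := by
      simpa using (tendsto_pow_atTop_nhds_zero_of_lt_one ((norm_nonneg _).trans hρ.le) hρ1).const_mul C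
    refine hT.ae_eq_zero (hV t).aemeasurable hlim (fun k => t + k) fun k => ?_
    have hrev (u : ℤ) : ∀ᵐ ω ∂P, V (-u) ω = (jordanBlock n lam)⁻¹ *ᵥ V (-(u - 1)) ω + 0 := by
      filter_upwards [hrec (-(u - 1))] with ω hω
      have h2 : -(u - 1) - 1 = -u := by ring
      rw [hω, h2, Matrix.mulVec_mulVec, Matrix.nonsing_inv_mul _ hdet, Matrix.one_mulVec, add_zero]
    filter_upwards [ae_eq_pow_mulVec_add (w := fun u => V (-u)) (ξ := fun _ _ => 0) hrev k (-t)]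
      with ω hω
    have h3 : -(-t - (k : ℤ)) = t + k := by ring
    simp only [neg_neg, h3, Matrix.mulVec_zero, Finset.sum_const_zero, add_zero] at hω
    rw [hω]
    exact hC k _

/-! ### The whole equation -/

theorem solution_add {Ω : Type*} {m d q H : ℕ} {Z : ℤ → Ω → (Fin d → ℂ)}
    {Θ : Fin (q + 1) → Matrix (Fin m) (Fin d) ℂ} {S : Matrix (Fin m) (Fin m) ℂ}
    {p : BlockPartition H m} {lam : Fin H → ℂ}
    (f : ∀ h, Fin (p.size h) → ℂ) (t s : ℤ) (ω : Ω) :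
    solution p lam S Θ Z f (t + s) ω = solution p lam S Θ (fun u => Z (u + s)) f t ω := by
  simp only [solution, blockSolution_add]

section Global

variable {Ω : Type*} [MeasurableSpace Ω] {P : Measure Ω} {m d q H : ℕ}
  {Z : ℤ → Ω → (Fin d → ℂ)} {Ψ : Matrix (Fin m) (Fin m) ℂ}
  {Θ : Fin (q + 1) → Matrix (Fin m) (Fin d) ℂ} {S : Matrix (Fin m) (Fin m) ℂ}
  {p : BlockPartition H m} {lam : Fin H → ℂ}

theorem proj_mul_inv_mul (hS : IsUnit S)
    (hJ : S⁻¹ * Ψ * S = p.blockDiag fun h => jordanBlock (p.size h) (lam h)) (h : Fin H) :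
    p.proj h * S⁻¹ * Ψ = jordanBlock (p.size h) (lam h) * (p.proj h * S⁻¹) := by
  have hdet := (Matrix.isUnit_iff_isUnit_det S).1 hS
  have h1 : S⁻¹ * Ψ = (p.blockDiag fun h => jordanBlock (p.size h) (lam h)) * S⁻¹ := by
    rw [← hJ, Matrix.mul_assoc, Matrix.mul_nonsing_inv _ hdet, Matrix.mul_one]
  rw [Matrix.mul_assoc, h1, ← Matrix.mul_assoc, p.proj_mul_blockDiag, Matrix.mul_assoc]

theorem eq_of_forall_proj_mul_inv_mulVec (hS : IsUnit S) {x y : Fin m → ℂ}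
    (h : ∀ h, (p.proj h * S⁻¹) *ᵥ x = (p.proj h * S⁻¹) *ᵥ y) : x = y := by
  have hdet := (Matrix.isUnit_iff_isUnit_det S).1 hS
  have h1 : S⁻¹ *ᵥ x = S⁻¹ *ᵥ y := p.ext_proj fun k => by
    rw [Matrix.mulVec_mulVec, Matrix.mulVec_mulVec]
    exact h k
  have h2 := congrArg (S *ᵥ ·) h1
  simpa [Matrix.mulVec_mulVec, Matrix.mul_nonsing_inv _ hdet] using h2

theorem proj_mul_inv_mulVec_stack (hS : IsUnit S) (x : ∀ h, Fin (p.size h) → ℂ) (h : Fin H) :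
    (p.proj h * S⁻¹) *ᵥ (S *ᵥ p.stack x) = x h := by
  have hdet := (Matrix.isUnit_iff_isUnit_det S).1 hS
  rw [Matrix.mulVec_mulVec, Matrix.mul_assoc, Matrix.nonsing_inv_mul _ hdet, Matrix.mul_one,
    p.proj_stack]

theorem equation_iff_forall_block (hS : IsUnit S)
    (hJ : S⁻¹ * Ψ * S = p.blockDiag fun h => jordanBlock (p.size h) (lam h))
    {y y' : Fin m → ℂ} {z : Fin (q + 1) → (Fin d → ℂ)} :
    y - Ψ *ᵥ y' = ∑ k, Θ k *ᵥ z k ↔ ∀ h, (p.proj h * S⁻¹) *ᵥ y -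
      jordanBlock (p.size h) (lam h) *ᵥ ((p.proj h * S⁻¹) *ᵥ y') =
        ∑ k, blockCoeff p S Θ h k *ᵥ z k := by
  have h1 (h : Fin H) : (p.proj h * S⁻¹) *ᵥ (y - Ψ *ᵥ y') = (p.proj h * S⁻¹) *ᵥ y -
      jordanBlock (p.size h) (lam h) *ᵥ ((p.proj h * S⁻¹) *ᵥ y') := by
    rw [Matrix.mulVec_sub, Matrix.mulVec_mulVec, Matrix.mulVec_mulVec, proj_mul_inv_mul hS hJ]
  have h2 (h : Fin H) : (p.proj h * S⁻¹) *ᵥ (∑ k, Θ k *ᵥ z k) =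
      ∑ k, blockCoeff p S Θ h k *ᵥ z k := by
    rw [Matrix.mulVec_sum]
    exact Finset.sum_congr rfl fun k _ => by rw [Matrix.mulVec_mulVec, blockCoeff]
  constructor
  · intro h h'
    rw [← h1, h, h2]
  · intro h
    refine eq_of_forall_proj_mul_inv_mulVec (p := p) hS fun h' => ?_
    rw [h1, h2, h h']

theorem measurable_solution (hZ : ∀ t, Measurable (Z t)) (f : ∀ h, Fin (p.size h) → ℂ) (t : ℤ) :
    Measurable (solution p lam S Θ Z f t) := by
  unfold solution BlockPartition.stack
  exact (measurable_mulVec S).comp (Finset.measurable_fun_sum _ fun h _ =>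
    (measurable_mulVec _).comp (measurable_blockSolution m (lam h) (f h) hZ t))

/-- No moment condition is needed: `tsum` has a value even where a series diverges, and the
resulting map remains measurable and shift-equivariant. -/
theorem isStrictlyStationary_solution (hZ : IsIID Z P) (f : ∀ h, Fin (p.size h) → ℂ) :
    IsStrictlyStationary (solution p lam S Θ Z f) P :=
  isStrictlyStationary_of_shift (W := fun ω t => Z t ω)
    (F := solution p lam S Θ (fun u (z : ℤ → Fin d → ℂ) => z u) f)
    (T := fun s z u => z (u + s))
    (measurable_pi_lambda _ hZ.measurable)
    (measurable_solution (fun u => measurable_pi_apply u) f)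
    (fun s => measurable_pi_lambda _ fun u => measurable_pi_apply (u + s))
    hZ.map_shift (fun t s x => solution_add f t s x)

theorem isStrictSolution_solution [IsProbabilityMeasure P] (hZ : IsIID Z P) (hS : IsUnit S)
    (hJ : S⁻¹ * Ψ * S = p.blockDiag fun h => jordanBlock (p.size h) (lam h))
    (hlog : ∀ h, ‖lam h‖ ≠ 0 → ‖lam h‖ ≠ 1 →
      ∫⁻ ω, ENNReal.ofReal (Real.posLog ‖blockVector p lam S Θ Z h ω‖) ∂P < ⊤)
    {f : ∀ h, Fin (p.size h) → ℂ}
    (hf : ∀ h, ‖lam h‖ = 1 → ∀ᵐ ω ∂P, blockVector p lam S Θ Z h ω =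
      (1 - jordanBlock (p.size h) (lam h)) *ᵥ f h) :
    IsStrictSolution P Ψ Θ Z (solution p lam S Θ Z f) where
  stationary := isStrictlyStationary_solution hZ f
  equation t := by
    have hblock (h : Fin H) : ∀ᵐ ω ∂P,
        blockSolution m (lam h) (blockCoeff p S Θ h) (f h) Z t ω - jordanBlock (p.size h) (lam h) *ᵥ
          blockSolution m (lam h) (blockCoeff p S Θ h) (f h) Z (t - 1) ω =
        ∑ k : Fin (q + 1), blockCoeff p S Θ h k *ᵥ Z (t - (k : ℕ)) ω := by
      by_cases h0 : lam h = 0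
      · rw [h0]
        exact Filter.Eventually.of_forall fun ω =>
          blockSolution_sub_eq_of_zero (p.size_le h) (f h) t ω
      have h0' : ‖lam h‖ ≠ 0 := norm_ne_zero_iff.2 h0
      rcases lt_trichotomy ‖lam h‖ 1 with h1 | h1 | h1
      · exact ae_blockSolution_eq_of_lt_one h0 h1 m (f h) hZ (hlog h h0' h1.ne) t
      · exact ae_blockSolution_eq_of_norm_eq_one h1 m rfl hZ (hf h h1) t
      · exact ae_blockSolution_eq_of_one_lt h1 m (f h) hZ (hlog h h0' h1.ne') t
    filter_upwards [ae_all_iff.2 hblock] with ω hω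
    rw [equation_iff_forall_block hS hJ]
    intro h
    rw [solution, solution, proj_mul_inv_mulVec_stack hS, proj_mul_inv_mulVec_stack hS]
    exact hω h

theorem IsStrictlyStationary.uniformlyTight_mulVec [IsProbabilityMeasure P]
    {Y : ℤ → Ω → (Fin m → ℂ)} (hY : IsStrictlyStationary Y P) {n : ℕ}
    (A : Matrix (Fin n) (Fin m) ℂ) : UniformlyTight (fun t ω => A *ᵥ Y t ω) P :=
  UniformlyTight.of_identDistrib fun s t => (hY.identDistrib s t).comp (measurable_mulVec A)

/-- Stationarity of w would require the joint law of Y and Z, about which nothing is assumed.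
Tightness of w follows from that of Y and of `recentNoise` separately. -/
theorem IsStrictSolution.exists_reduced [IsProbabilityMeasure P] (hZ : IsIID Z P) (hS : IsUnit S)
    (hJ : S⁻¹ * Ψ * S = p.blockDiag fun h => jordanBlock (p.size h) (lam h))
    {Y : ℤ → Ω → (Fin m → ℂ)} (hY : IsStrictSolution P Ψ Θ Z Y) (h : Fin H) :
    ∃ w : ℤ → Ω → (Fin (p.size h) → ℂ), (∀ t, Measurable (w t)) ∧ UniformlyTight w P ∧
      ∀ t, ∀ᵐ ω ∂P, w t ω = jordanBlock (p.size h) (lam h) *ᵥ w (t - 1) ω +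
        momentMatrix (jordanBlock (p.size h) (lam h)) (blockCoeff p S Θ h) *ᵥ Z (t - q) ω := by
  have hm (t : ℤ) : Measurable fun ω => (p.proj h * S⁻¹) *ᵥ Y t ω :=
    (measurable_mulVec _).comp (hY.stationary.measurable t)
  refine ⟨fun t ω => (p.proj h * S⁻¹) *ᵥ Y t ω -
    recentNoise (jordanBlock (p.size h) (lam h)) (blockCoeff p S Θ h) Z t ω,
    fun t => (hm t).sub (measurable_recentNoise hZ.measurable t),
    (hY.stationary.uniformlyTight_mulVec _).sub hZ.uniformlyTight_recentNoise
      fun t => (hm t).aemeasurable, fun t => ?_⟩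
  filter_upwards [hY.equation t] with ω hω
  exact (sub_mulVec_eq_sum_iff (X := fun t ω => (p.proj h * S⁻¹) *ᵥ Y t ω)).1
    ((equation_iff_forall_block hS hJ).1 hω h)

theorem IsStrictSolution.lintegral_posLog_lt_top [IsProbabilityMeasure P] (hZ : IsIID Z P)
    (hS : IsUnit S)
    (hJ : S⁻¹ * Ψ * S = p.blockDiag fun h => jordanBlock (p.size h) (lam h))
    {Y : ℤ → Ω → (Fin m → ℂ)} (hY : IsStrictSolution P Ψ Θ Z Y) {h : Fin H}
    (h0 : ‖lam h‖ ≠ 0) (h1 : ‖lam h‖ ≠ 1) :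
    ∫⁻ ω, ENNReal.ofReal (Real.posLog ‖blockVector p lam S Θ Z h ω‖) ∂P < ⊤ := by
  obtain ⟨w, hw, hT, hrec⟩ := hY.exists_reduced hZ hS hJ h
  have h0' : lam h ≠ 0 := norm_ne_zero_iff.1 h0
  set ξ : ℤ → Ω → (Fin (p.size h) → ℂ) := fun t ω =>
    momentMatrix (jordanBlock (p.size h) (lam h)) (blockCoeff p S Θ h) *ᵥ Z (t - q) ω with hξdef
  have hξ : IsIID ξ P := hZ.mulVec _ _
  have key : ∫⁻ ω, ENNReal.ofReal (Real.posLog ‖ξ q ω‖) ∂P < ⊤ := by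
    refine ((hξ.identDistrib q 0).comp measurable_ofReal_posLog_norm).lintegral_eq.trans_lt ?_
    rcases lt_or_gt_of_ne h1 with h2 | h2
    · exact lintegral_posLog_lt_top_of_recursion (ξ := ξ) (jordanBlock_sub_smul_one_pow _) h2 h0'
        (isUnit_jordanBlock h0') hw hT hξ hrec
    · exact lintegral_posLog_lt_top_of_recursion_expanding (ξ := ξ)
        (jordanBlock_sub_smul_one_pow _) h2 (isUnit_jordanBlock h0') hw hT hξ hrec
  simpa only [hξdef, sub_self, blockVector] using key

theorem IsStrictSolution.exists_ae_blockVector_eq [IsProbabilityMeasure P] (hZ : IsIID Z P)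
    (hS : IsUnit S)
    (hJ : S⁻¹ * Ψ * S = p.blockDiag fun h => jordanBlock (p.size h) (lam h))
    {Y : ℤ → Ω → (Fin m → ℂ)} (hY : IsStrictSolution P Ψ Θ Z Y) {h : Fin H} (h1 : ‖lam h‖ = 1) :
    ∃ α : Fin (p.size h) → ℂ, (lam h = 1 → α (p.first h) = 0) ∧
      ∀ᵐ ω ∂P, blockVector p lam S Θ Z h ω = α := by
  obtain ⟨w, hw, hT, hrec⟩ := hY.exists_reduced hZ hS hJ h
  have hξ := hZ.mulVec (momentMatrix (jordanBlock (p.size h) (lam h)) (blockCoeff p S Θ h)) (q : ℤ)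
  obtain ⟨α, hα⟩ := exists_ae_eq_const_of_recursion h1 hw hT hξ hrec
  refine ⟨α, fun h2 => ?_, ?_⟩
  · refine apply_first_eq_zero_of_recursion hw hT (fun t => ?_) (i := p.first h) rfl
    filter_upwards [hrec t, hα t] with ω h3 h4
    rw [h3, h4, h2]
  · filter_upwards [hα q] with ω hω
    rw [sub_self] at hω
    exact hω

theorem IsStrictSolution.ae_eq_of_norm_ne_one [IsProbabilityMeasure P] (hS : IsUnit S)
    (hJ : S⁻¹ * Ψ * S = p.blockDiag fun h => jordanBlock (p.size h) (lam h))
    {Y X : ℤ → Ω → (Fin m → ℂ)} (hY : IsStrictSolution P Ψ Θ Z Y)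
    (hX : IsStrictSolution P Ψ Θ Z X) (h1 : ∀ h, ‖lam h‖ ≠ 1) (t : ℤ) : Y t =ᵐ[P] X t := by
  have hblock (h : Fin H) : (fun ω => (p.proj h * S⁻¹) *ᵥ Y t ω - (p.proj h * S⁻¹) *ᵥ X t ω)
      =ᵐ[P] 0 := by
    have hm {W : ℤ → Ω → (Fin m → ℂ)} (hW : IsStrictSolution P Ψ Θ Z W) (t : ℤ) :
        Measurable fun ω => (p.proj h * S⁻¹) *ᵥ W t ω :=
      (measurable_mulVec _).comp (hW.stationary.measurable t)
    refine ae_eq_zero_of_homogeneous_recursion (h1 h)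
      (V := fun t ω => (p.proj h * S⁻¹) *ᵥ Y t ω - (p.proj h * S⁻¹) *ᵥ X t ω)
      (fun t => (hm hY t).sub (hm hX t))
      ((hY.stationary.uniformlyTight_mulVec _).sub (hX.stationary.uniformlyTight_mulVec _)
        fun t => (hm hY t).aemeasurable) (fun t => ?_) t
    filter_upwards [hY.equation t, hX.equation t] with ω h2 h3
    have h4 := (equation_iff_forall_block hS hJ).1 h2 h
    have h5 := (equation_iff_forall_block hS hJ).1 h3 h
    rw [Matrix.mulVec_sub, ← sub_eq_zero, ← sub_eq_zero.2 (h4.trans h5.symm)]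
    abel
  filter_upwards [ae_all_iff.2 hblock] with ω hω
  exact eq_of_forall_proj_mul_inv_mulVec (p := p) hS fun h => sub_eq_zero.1 (hω h)

end Global

/-! ### Non-uniqueness in the presence of an eigenvalue of modulus one -/

section NonUnique

variable {Ω : Type*} [MeasurableSpace Ω] {P : Measure Ω} {m d q H : ℕ}
  {Z : ℤ → Ω → (Fin d → ℂ)} {Ψ : Matrix (Fin m) (Fin m) ℂ}
  {Θ : Fin (q + 1) → Matrix (Fin m) (Fin d) ℂ} {S : Matrix (Fin m) (Fin m) ℂ}
  {p : BlockPartition H m} {lam : Fin H → ℂ}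

theorem map_mk_unitAddCircle_eq_volume {U : Ω → ℝ} (hU : Measurable U)
    (hmap : P.map U = volume.restrict (Set.Ico 0 1)) :
    P.map (fun ω => (U ω : UnitAddCircle)) = volume := by
  have h1 := UnitAddCircle.measurePreserving_mk 0
  rw [zero_add] at h1
  rw [← h1.map_eq, ← Measure.restrict_congr_set (Ico_ae_eq_Ioc (μ := volume) (a := (0 : ℝ)) (b := 1)),
    ← hmap, Measure.map_map h1.measurable hU]
  rfl

/-- Adding sθ to the phase preserves Haar measure on the circle. By independence, the joint law of Z
and the phase is thus invariant under shifting Z and rotating the phase together. -/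
theorem isStrictlyStationary_solution_add [IsProbabilityMeasure P] (hZ : IsIID Z P)
    (f : ∀ h, Fin (p.size h) → ℂ) {U : Ω → ℝ} (hU : Measurable U)
    (hmap : P.map U = volume.restrict (Set.Ico 0 1)) (hind : IndepFun U (fun ω t => Z t ω) P)
    (θ : UnitAddCircle) (v : Fin m → ℂ) :
    IsStrictlyStationary (fun t ω => solution p lam S Θ Z f t ω +
      ((AddCircle.toCircle ((U ω : UnitAddCircle) + t • θ) : Circle) : ℂ) • v) P := by
  have hmk : Measurable fun x : ℝ => (x : UnitAddCircle) := AddCircle.measurable_mk'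
  have hZm : Measurable fun ω t => Z t ω := measurable_pi_lambda _ hZ.measurable
  have hsh (s : ℤ) : Measurable fun (z : ℤ → Fin d → ℂ) (u : ℤ) => z (u + s) :=
    measurable_pi_lambda _ fun u => measurable_pi_apply (u + s)
  have hadd (s : ℤ) : Measurable fun y : UnitAddCircle => y + s • θ := measurable_id.add_const _
  have hW : Measurable fun ω => ((fun t => Z t ω), (U ω : UnitAddCircle)) :=
    hZm.prodMk (hmk.comp hU)
  have hlaw : P.map (fun ω => ((fun t => Z t ω), (U ω : UnitAddCircle))) =
      (P.map fun ω t => Z t ω).prod volume := by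
    rw [← map_mk_unitAddCircle_eq_volume hU hmap]
    exact (indepFun_iff_map_prod_eq_prod_map_map hZm.aemeasurable
      (hmk.comp hU).aemeasurable).1 (hind.symm.comp measurable_id hmk)
  have := Measure.isProbabilityMeasure_map (μ := P) hZm.aemeasurable
  refine isStrictlyStationary_of_shift (W := fun ω => ((fun t => Z t ω), (U ω : UnitAddCircle)))
    (F := fun t x => solution p lam S Θ (fun u (z : ℤ → Fin d → ℂ) => z u) f t x.1 +
      ((AddCircle.toCircle (x.2 + t • θ) : Circle) : ℂ) • v)
    (T := fun s => Prod.map (fun z u => z (u + s)) (· + s • θ))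
    hW (fun t => ?_) (fun s => ?_) (fun s => ?_) (fun t s x => ?_)
  · refine ((measurable_solution (fun u => measurable_pi_apply u) f t).comp measurable_fst).add ?_
    have hc : Continuous fun y : UnitAddCircle =>
        ((AddCircle.toCircle (y + t • θ) : Circle) : ℂ) • v := by
      refine Continuous.smul (continuous_subtype_val.comp
        (AddCircle.continuous_toCircle.comp (continuous_id.add continuous_const))) continuous_const
    exact hc.measurable.comp measurable_snd
  · exact (hsh s).prodMap (hadd s)
  · have h1 : (fun ω => Prod.map (fun (z : ℤ → Fin d → ℂ) (u : ℤ) => z (u + s)) (· + s • θ)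
        ((fun t => Z t ω), (U ω : UnitAddCircle))) =
        Prod.map (fun (z : ℤ → Fin d → ℂ) (u : ℤ) => z (u + s)) (· + s • θ) ∘
          fun ω => ((fun t => Z t ω), (U ω : UnitAddCircle)) := rfl
    rw [h1, ← Measure.map_map ((hsh s).prodMap (hadd s)) hW, hlaw,
      ← Measure.map_prod_map _ _ (hsh s) (hadd s),
      Measure.map_map (hsh s) hZm, map_add_right_eq_self]
    congr 1
    exact hZ.map_shift s
  · simp only [Prod.map_fst, Prod.map_snd]
    rw [solution_add, add_smul, add_comm (t • θ), add_assoc]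
    rfl

theorem exists_isStrictSolution_ne [IsProbabilityMeasure P] (hZ : IsIID Z P) (hS : IsUnit S)
    (hJ : S⁻¹ * Ψ * S = p.blockDiag fun h => jordanBlock (p.size h) (lam h))
    {f : ∀ h, Fin (p.size h) → ℂ}
    (hsol : IsStrictSolution P Ψ Θ Z (solution p lam S Θ Z f)) (hunif : HasIndepUniform P Z)
    {h₀ : Fin H} (h1 : ‖lam h₀‖ = 1) :
    ∃ Y, IsStrictSolution P Ψ Θ Z Y ∧ ∀ t ω, Y t ω ≠ solution p lam S Θ Z f t ω := by
  obtain ⟨U, hU, hmap, hind⟩ := hunif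
  obtain ⟨θ, hθ⟩ : ∃ θ : UnitAddCircle, ((AddCircle.toCircle θ : Circle) : ℂ) = lam h₀ := by
    obtain ⟨θ, hθ⟩ := (AddCircle.homeomorphCircle (T := 1) one_ne_zero).surjective
      ⟨lam h₀, mem_sphere_zero_iff_norm.2 h1⟩
    rw [AddCircle.homeomorphCircle_apply] at hθ
    exact ⟨θ, by rw [hθ]⟩
  -- The last basis vector of a block is an eigenvector, since the subdiagonal has no row to carry
  -- it to.
  let e : Fin (p.size h₀) → ℂ := Pi.single ⟨p.size h₀ - 1, Nat.sub_lt (p.size_pos h₀) one_pos⟩ 1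
  let x : ∀ h, Fin (p.size h) → ℂ := Pi.single h₀ e
  have hx (h : Fin H) : jordanBlock (p.size h) (lam h) *ᵥ x h = lam h₀ • x h := by
    by_cases hh : h = h₀
    · subst hh
      simp only [x, Pi.single_eq_same]
      exact jordanBlock_mulVec_single_last (p.size_pos h) (lam h)
    · simp only [x, Pi.single_eq_of_ne hh, Matrix.mulVec_zero, smul_zero]
  have hx0 : S *ᵥ p.stack x ≠ 0 := by
    intro h0
    have h2 := proj_mul_inv_mulVec_stack hS x h₀
    rw [h0, Matrix.mulVec_zero] at h2
    have h3 := congrFun h2 ⟨p.size h₀ - 1, Nat.sub_lt (p.size_pos h₀) one_pos⟩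
    simp [x, e] at h3
  refine ⟨_, ⟨isStrictlyStationary_solution_add (Θ := Θ) (S := S)
    (lam := lam) hZ f hU hmap hind θ (S *ᵥ p.stack x),
    fun t => ?_⟩, fun t ω h2 => ?_⟩
  · filter_upwards [hsol.equation t] with ω hω
    rw [equation_iff_forall_block hS hJ] at hω ⊢
    intro h
    rw [← hω h, Matrix.mulVec_add, Matrix.mulVec_add, Matrix.mulVec_smul, Matrix.mulVec_smul,
      proj_mul_inv_mulVec_stack hS, Matrix.mulVec_add, Matrix.mulVec_smul, hx, smul_smul]
    have h3 : ((AddCircle.toCircle ((U ω : UnitAddCircle) + t • θ) : Circle) : ℂ) =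
        ((AddCircle.toCircle ((U ω : UnitAddCircle) + (t - 1) • θ) : Circle) : ℂ) * lam h₀ := by
      have h4 : (U ω : UnitAddCircle) + t • θ = (U ω : UnitAddCircle) + (t - 1) • θ + θ := by
        rw [sub_smul, one_smul]; abel
      rw [h4, AddCircle.toCircle_add, Circle.coe_mul, hθ]
    rw [h3]
    abel
  · rw [add_eq_left] at h2
    exact (smul_ne_zero (Circle.coe_ne_zero _) hx0) h2

end NonUnique

end StrictARMA

open StrictARMA in
theorem theorem1
    {m d q H : ℕ} (hm : 1 ≤ m) (hd : 1 ≤ d)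
    {Ω : Type*} [MeasurableSpace Ω] (P : Measure Ω) [IsProbabilityMeasure P]
    (Z : ℤ → Ω → (Fin d → ℂ)) (hZ : IsIID Z P)
    (Ψ : Matrix (Fin m) (Fin m) ℂ) (Θ : Fin (q + 1) → Matrix (Fin m) (Fin d) ℂ)
    (S : Matrix (Fin m) (Fin m) ℂ) (hS : IsUnit S)
    (p : BlockPartition H m) (lam : Fin H → ℂ)
    (hJ : S⁻¹ * Ψ * S = p.blockDiag fun h => jordanBlock (p.size h) (lam h))
    -- an arbitrary vector norm on each `ℂ^s`
    (N : ∀ s : ℕ, Seminorm ℂ (Fin s → ℂ)) (hN : ∀ (s : ℕ) (x : Fin s → ℂ), N s x = 0 → x = 0) :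
    -- existence
    ((∃ Y, IsStrictSolution P Ψ Θ Z Y) ↔ Conditions N P p lam S Θ Z) ∧
    (Conditions N P p lam S Θ Z →
      -- the matrix `Id - Φ_h` is invertible if `|λ_h| = 1` and `λ_h ≠ 1`
      (∀ h, ‖lam h‖ = 1 → lam h ≠ 1 → IsUnit (1 - jordanBlock (p.size h) (lam h))) ∧
      -- the series converge absolutely, almost surely
      (∀ h, 0 < ‖lam h‖ → ‖lam h‖ < 1 → ∀ t : ℤ, ∀ᵐ ω ∂P, Summable fun j : ℕ =>
        N _ (pastTerm (jordanBlock (p.size h) (lam h)) (blockCoeff p S Θ h) Z t j ω)) ∧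
      (∀ h, 1 < ‖lam h‖ → ∀ t : ℤ, ∀ᵐ ω ∂P, Summable fun i : ℕ =>
        N _ (futureTerm (jordanBlock (p.size h) (lam h)) (blockCoeff p S Θ h) Z t
          ((i : ℤ) + 1 - (q : ℤ)) ω)) ∧
      -- `α h` is the constant value of the random vector of each block with `|λ_h| = 1`
      ∀ α : ∀ h, Fin (p.size h) → ℂ,
        (∀ h, ‖lam h‖ = 1 → ∀ᵐ ω ∂P, blockVector p lam S Θ Z h ω = α h) →
        -- the equations for `f_h` are solvable
        (∀ h, ‖lam h‖ = 1 →
          ∃ f : Fin (p.size h) → ℂ, (1 - jordanBlock (p.size h) (lam h)) *ᵥ f = α h) ∧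
        -- any choice of solutions `f_h` gives a strictly stationary solution
        ∀ f : ∀ h, Fin (p.size h) → ℂ,
          (∀ h, ‖lam h‖ = 1 → (1 - jordanBlock (p.size h) (lam h)) *ᵥ f h = α h) →
          IsStrictSolution P Ψ Θ Z (solution p lam S Θ Z f) ∧
          -- uniqueness
          (HasIndepUniform P Z →
            ((∀ Y, IsStrictSolution P Ψ Θ Z Y → ∀ t : ℤ, Y t =ᵐ[P] solution p lam S Θ Z f t) ↔
              ∀ h, ‖lam h‖ ≠ 1))) := by
  have hlog (hC : Conditions N P p lam S Θ Z) (h : Fin H) (h0 : ‖lam h‖ ≠ 0)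
      (h1 : ‖lam h‖ ≠ 1) :
      ∫⁻ ω, ENNReal.ofReal (Real.posLog ‖blockVector p lam S Θ Z h ω‖) ∂P < ⊤ := by
    obtain ⟨C, -, hle⟩ := exists_le_seminorm (hN (p.size h))
    exact lintegral_posLog_lt_top_of_le (fun ω => norm_nonneg _) (fun ω => hle _)
      (hC.log_moment h h0 h1)
  have hunit (h : Fin H) (h1 : lam h ≠ 1) := isUnit_one_sub_jordanBlock (n := p.size h) h1
  have hsummable {s : ℕ} {x : ℕ → Fin s → ℂ} (hx : Summable fun j => ‖x j‖) :
      Summable fun j => N s (x j) := by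
    obtain ⟨C, -, hle⟩ := exists_seminorm_le (N s)
    exact Summable.of_nonneg_of_le (fun j => apply_nonneg _ _) (fun j => hle _) (hx.mul_left C)
  have hsolv (hC : Conditions N P p lam S Θ Z) (h : Fin H) (h1 : ‖lam h‖ = 1)
      (α : Fin (p.size h) → ℂ) (hα : ∀ᵐ ω ∂P, blockVector p lam S Θ Z h ω = α) :
      ∃ f : Fin (p.size h) → ℂ, (1 - jordanBlock (p.size h) (lam h)) *ᵥ f = α := by
    by_cases hl : lam h = 1
    · obtain ⟨β, hβ0, hβ⟩ := hC.constant_one h hl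
      -- Two almost sure constant values of one random vector coincide, so the given α inherits the
      -- zero first entry from condition (iii).
      obtain ⟨ω, h2, h3⟩ := (hα.and hβ).exists
      have hαβ : α = β := h2.symm.trans h3
      rw [hl]
      refine exists_one_sub_jordanBlock_one_mulVec_eq α fun i hi => ?_
      rw [hαβ, show i = p.first h from Fin.ext hi, hβ0]
    · have hdet := (Matrix.isUnit_iff_isUnit_det _).1 (hunit h hl)
      refine ⟨(1 - jordanBlock (p.size h) (lam h))⁻¹ *ᵥ α, ?_⟩
      rw [Matrix.mulVec_mulVec, Matrix.mul_nonsing_inv _ hdet, Matrix.one_mulVec]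
  have hsol (hC : Conditions N P p lam S Θ Z) (α : ∀ h, Fin (p.size h) → ℂ)
      (hα : ∀ h, ‖lam h‖ = 1 → ∀ᵐ ω ∂P, blockVector p lam S Θ Z h ω = α h)
      (f : ∀ h, Fin (p.size h) → ℂ)
      (hf : ∀ h, ‖lam h‖ = 1 → (1 - jordanBlock (p.size h) (lam h)) *ᵥ f h = α h) :
      IsStrictSolution P Ψ Θ Z (solution p lam S Θ Z f) :=
    isStrictSolution_solution hZ hS hJ (hlog hC) fun h h1 => by rw [hf h h1]; exact hα h h1
  refine ⟨⟨?_, fun hC => ?_⟩, fun hC => ⟨fun h _ hl => hunit h hl, fun h h0 h1 t => ?_,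
    fun h h1 t => ?_, fun α hα => ⟨fun h h1 => hsolv hC h h1 (α h) (hα h h1), fun f hf =>
      ⟨hsol hC α hα f hf, fun hunif => ⟨fun hall h h1 => ?_, fun h1 Y hY t =>
        hY.ae_eq_of_norm_ne_one hS hJ (hsol hC α hα f hf) h1 t⟩⟩⟩⟩⟩
  · rintro ⟨Y, hY⟩
    refine ⟨fun h h0 h1 => ?_, fun h h1 _ => ?_, fun h hl => ?_⟩
    · obtain ⟨C, -, hle⟩ := exists_seminorm_le (N (p.size h))
      exact lintegral_posLog_lt_top_of_le (fun ω => apply_nonneg _ _) (fun ω => hle _)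
        (hY.lintegral_posLog_lt_top hZ hS hJ h0 h1)
    · obtain ⟨α, -, hα⟩ := hY.exists_ae_blockVector_eq hZ hS hJ h1
      exact ⟨α, hα⟩
    · obtain ⟨α, hα0, hα⟩ := hY.exists_ae_blockVector_eq hZ hS hJ
        (show ‖lam h‖ = 1 by rw [hl, norm_one])
      exact ⟨α, hα0 hl, hα⟩
  -- Blocks off the unit circle receive the irrelevant value 0, so that α and f are defined for
  -- every h.
  · have hex (h : Fin H) : ∃ α : Fin (p.size h) → ℂ, ‖lam h‖ = 1 →
        ∀ᵐ ω ∂P, blockVector p lam S Θ Z h ω = α := by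
      by_cases h1 : ‖lam h‖ = 1
      · by_cases hl : lam h = 1
        · obtain ⟨α, -, hα⟩ := hC.constant_one h hl
          exact ⟨α, fun _ => hα⟩
        · obtain ⟨α, hα⟩ := hC.constant h h1 hl
          exact ⟨α, fun _ => hα⟩
      · exact ⟨0, fun h2 => absurd h2 h1⟩
    choose α hα using hex
    have hexf (h : Fin H) : ∃ f : Fin (p.size h) → ℂ, ‖lam h‖ = 1 →
        (1 - jordanBlock (p.size h) (lam h)) *ᵥ f = α h := by
      by_cases h1 : ‖lam h‖ = 1
      · obtain ⟨f, hf⟩ := hsolv hC h h1 (α h) (hα h h1)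
        exact ⟨f, fun _ => hf⟩
      · exact ⟨0, fun h2 => absurd h2 h1⟩
    choose f hf using hexf
    exact ⟨_, hsol hC α hα f hf⟩
  · filter_upwards [ae_summable_pastTerm (norm_pos_iff.1 h0) h1 hZ (hlog hC h h0.ne' h1.ne) t]
      with ω hω
    exact hsummable hω
  · have h0 : lam h ≠ 0 := norm_pos_iff.1 (zero_lt_one.trans h1)
    filter_upwards [ae_summable_inv_pow_mulVec h1 hZ (hlog hC h (norm_ne_zero_iff.2 h0) h1.ne')
      (t - q)] with ω hω
    exact hsummable (summable_futureTerm h0 hω)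
  · obtain ⟨Y, hY, hne⟩ := exists_isStrictSolution_ne hZ hS hJ (hsol hC α hα f hf) hunif h1
    obtain ⟨ω, hω⟩ := (hall Y hY 0).exists
    exact hne 0 ω hω
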